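/- **Circuits.** Mixed circuits are the morphisms of the free coloured prop (free strict symmetric monoidal category) on two colours $\mathsf B$ (Boolean) and $\mathsf R$ (real) and the generators: copy $a\to aa$ and discard $a\to\varepsilon$ for each colour $a$; conjunction $\mathsf{BB}\to\mathsf B$, negation $\mathsf B\to\mathsf B$ and a coin $\mathsf{flip}_p:\varepsilon\to\mathsf B$ ($p\in[0,1]$, true with probability $p$); $0,1:\varepsilon\to\mathsf R$, addition $\mathsf{RR}\to\mathsf R$, multiplication by $k\in\mathbb R$, and a standard normal sample $\mathcal N:\varepsilon\to\mathsf R$; and if-then-else $\mathsf{BRR}\to\mathsf R$, written $\mathrm{ite}(b,x,y)$ (returning $x$ if $b$ is true, $y$ otherwise). A circuit is *Boolean* (resp. *Gaussian*) if it is built on $\mathsf B$-wires (resp. $\mathsf R$-wires) from the Boolean (resp. real) generators alone. Each circuit denotes a Markov kernel in the obvious way. The $n$-ary $\mathrm{ite}:\mathsf B\mathsf R^n\mathsf R^n\to\mathsf R^n$ consists of $n$ if-then-else gates sharing one guard. **Theory.** $\mathsf{CGM}$-equality is the least congruence (for sequential and parallel composition) containing the laws of strict symmetric monoidal categories and such that: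 (0) any two Boolean circuits, and any two Gaussian circuits, of the same type that denote the same kernel are equal; (1) copy and discard form a cocommutative comonoid for each colour; $0$, addition, scalars, $1$, conjunction and negation can be copied and discarded (copying, resp. discarding, the output equals copying the inputs and using two copies of the gate, resp. discarding the inputs); $\mathsf{flip}_p$ and $\mathcal N$ can be discarded; (2) $\mathrm{ite}(b,\mathrm{ite}(b,x,y),z)=\mathrm{ite}(b,x,z)=\mathrm{ite}(b,x,\mathrm{ite}(b,y,z))$; (3) $\mathrm{ite}(\mathsf{flip}_1,x,y)=x$ and $\mathrm{ite}(\mathsf{flip}_0,x,y)=y$; (4) $\mathrm{ite}(a,\mathrm{ite}(b,x,y),\mathrm{ite}(b,z,w))=\mathrm{ite}(b,\mathrm{ite}(a,x,z),\mathrm{ite}(a,y,w))$; (5) for all circuits $c:\mathsf R\mathsf R^k\to\mathsf R^n$ and $d:\mathsf R\mathsf R^l\to\mathsf R^n$, $\mathrm{ite}(b,c(g,x),d(g,y))=\mathrm{ite}(b,c(g_1,x),d(g_2,y))$, where $g$ is one shared normal sample and $g_1,g_2$ are two separate ones; (6) for every circuit $c:\mathsf R^m\to\mathsf R^n$, $c(\mathrm{ite}(b,x,y))=\mathrm{ite}(b,c(x),c(y))$;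 (7) $\mathrm{ite}(\neg b,x,y)=\mathrm{ite}(b,y,x)$; $\mathrm{ite}(a\wedge b,x,y)=\mathrm{ite}(a,\mathrm{ite}(b,x,y),y)$; $\mathrm{ite}(b,x,x)=x$; discarding the output of $\mathrm{ite}$ equals discarding its three inputs; (8) $\mathrm{ite}(\mathsf{flip}_q,\mathrm{ite}(\mathsf{flip}_p,x,y),z)=\mathrm{ite}(\mathsf{flip}_{\tilde p},x,\mathrm{ite}(\mathsf{flip}_{\tilde q},y,z))$ for $\tilde p=pq\ne1$ and $\tilde q=\frac{q(1-p)}{1-pq}$. Here a variable that occurs several times stands for a copied wire, and one that does not occur for a discarded wire. In (2)–(4), (7) and (8) each of $x,y,z,w$ is a single real wire. **Normal forms.** A circuit $\mathsf R^m\to\mathsf R^n$ is in *convex normal form* (CNF) if it is a Gaussian circuit, or (inductively) it is $x\mapsto\mathrm{ite}(\mathsf{flip}_p,c(x),d(x))$ with $p\in(0,1)$, $c$ Gaussian and $d$ in CNF. A circuit $\mathsf B^p\mathsf R^m\to\mathsf R^n$ is in *normal form* (NF) if $p=0$ and it is in CNF, or $p\geq1$ and it is $(b,a,x)\mapsto\mathrm{ite}(b,c(a,x),d(a,x))$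 with $b$ the first Boolean input and $c,d:\mathsf B^{p-1}\mathsf R^m\to\mathsf R^n$ in NF. **Theorem.** For all $p,m,n\ge0$, every circuit $\mathsf B^p\mathsf R^m\to\mathsf R^n$ is $\mathsf{CGM}$-equal to a circuit in normal form. -/

import Mathlib

open MeasureTheory ProbabilityTheory

namespace MixCirc

/-! ### Syntax: the two-coloured prop of mixed circuits -/

/-- The two colours: Boolean wires and real wires. -/
inductive Col where
  | B
  | R

/-- The word made of `p` Boolean wires. -/
abbrev Bw (p : ℕ) : List Col := List.replicate p Col.B

/-- The word made of `m` real wires. -/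
abbrev Rw (m : ℕ) : List Col := List.replicate m Col.R

/-- Terms for mixed circuits from the word `v` to the word `w`: the generators, closed under
identities, symmetries, sequential composition and parallel composition. The symmetries are
given for all pairs of words; by the laws below they are composites of the crossings of single
wires. The laws of strict symmetric monoidal categories are part of every equality of circuits
considered below. -/
inductive Circ : List Col → List Col → Type where
  /-- identity wires -/
  | idn (v : List Col) : Circ v v
  /-- crossing of two bundles of wires -/
  | swap (v w : List Col) : Circ (v ++ w) (w ++ v)
  /-- sequential composition, in diagrammatic order -/
  | seq {u v w : List Col} (c : Circ u v) (d : Circ v w) : Circ u w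
  /-- parallel composition -/
  | par {v w v' w' : List Col} (c : Circ v w) (d : Circ v' w') : Circ (v ++ v') (w ++ w')
  /-- discarding a wire (either colour) -/
  | del (a : Col) : Circ [a] []
  /-- copying a wire (either colour) -/
  | copy (a : Col) : Circ [a] [a, a]
  /-- conjunction -/
  | conj : Circ [Col.B, Col.B] [Col.B]
  /-- negation -/
  | neg : Circ [Col.B] [Col.B]
  /-- the biased coin: true with probability `p` -/
  | flip (p : unitInterval) : Circ [] [Col.B]
  /-- the constant `0` -/
  | zero : Circ [] [Col.R]
  /-- addition -/
  | add : Circ [Col.R, Col.R] [Col.R]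
  /-- multiplication by `k` -/
  | scal (k : ℝ) : Circ [Col.R] [Col.R]
  /-- the constant `1` -/
  | one : Circ [] [Col.R]
  /-- a sample of the standard normal distribution -/
  | normal : Circ [] [Col.R]
  /-- if-then-else: the second input if the guard is true, the third input otherwise -/
  | sel : Circ [Col.B, Col.R, Col.R] [Col.R]

notation:60 c:61 " ⨾ " d:60 => Circ.seq (c :) (d :)
infixr:70 " ⊠ " => Circ.par

open Circ Col

/-- The identity circuit between two words that are equal (for instance by associativity of
concatenation). -/
def wire {v w : List Col} (h : v = w) : Circ v w := h ▸ Circ.idn v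

/-- The crossing of the two middle bundles of four. -/
def mid (a b c d : List Col) : Circ ((a ++ b) ++ (c ++ d)) ((a ++ c) ++ (b ++ d)) :=
  have h (x y : List Col) : (a ++ x) ++ (y ++ d) = a ++ ((x ++ y) ++ d) := by simp
  wire (h b c) ⨾ (idn a ⊠ swap b c ⊠ idn d) ⨾ wire (h c b).symm

/-- Copying a bundle of wires. -/
def copyW : (v : List Col) → Circ v (v ++ v)
  | [] => idn []
  | a :: v => (copy a ⊠ copyW v) ⨾ mid [a] [a] v v

/-- Discarding a bundle of wires. -/
def delW : (v : List Col) → Circ v []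
  | [] => idn []
  | a :: v => del a ⊠ delW v

/-- The `n`-ary if-then-else: `n` if-then-else gates sharing one guard. -/
def selN : (n : ℕ) → Circ ([B] ++ (Rw n ++ Rw n)) (Rw n)
  | 0 => del B
  | n + 1 =>
      (copy B ⊠ mid [R] (Rw n) [R] (Rw n)) ⨾ mid [B] [B] [R, R] (Rw n ++ Rw n) ⨾ (sel ⊠ selN n)

/-- The circuit that behaves as `c` if its first input is true, and as `d` otherwise; the
remaining inputs are copied to `c` and `d`. -/
def cond {v : List Col} {n : ℕ} (c d : Circ v (Rw n)) : Circ (B :: v) (Rw n) :=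
  (idn [B] ⊠ copyW v) ⨾ (idn [B] ⊠ c ⊠ d) ⨾ selN n

/-- The circuit that behaves as `c` with probability `p`, and as `d` with probability `1 - p`;
the inputs are copied to `c` and `d`. -/
def mix {v : List Col} {n : ℕ} (p : unitInterval) (c d : Circ v (Rw n)) : Circ v (Rw n) :=
  (flip p ⊠ idn v) ⨾ cond c d

/-! ### The Boolean and the Gaussian fragment -/

/-- Boolean circuits: those built on Boolean wires from the Boolean generators. -/
def IsBool : {v w : List Col} → Circ v w → Prop
  | _, _, .idn v => ∀ a ∈ v, a = B
  | _, _, .swap v w => ∀ a ∈ v ++ w, a = B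
  | _, _, .seq c d => IsBool c ∧ IsBool d
  | _, _, .par c d => IsBool c ∧ IsBool d
  | _, _, .del a => a = B
  | _, _, .copy a => a = B
  | _, _, .conj => True
  | _, _, .neg => True
  | _, _, .flip _ => True
  | _, _, .zero => False
  | _, _, .add => False
  | _, _, .scal _ => False
  | _, _, .one => False
  | _, _, .normal => False
  | _, _, .sel => False

/-- Gaussian circuits: those built on real wires from the real generators. -/
def IsGauss : {v w : List Col} → Circ v w → Prop
  | _, _, .idn v => ∀ a ∈ v, a = R
  | _, _, .swap v w => ∀ a ∈ v ++ w, a = R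
  | _, _, .seq c d => IsGauss c ∧ IsGauss d
  | _, _, .par c d => IsGauss c ∧ IsGauss d
  | _, _, .del a => a = R
  | _, _, .copy a => a = R
  | _, _, .conj => False
  | _, _, .neg => False
  | _, _, .flip _ => False
  | _, _, .zero => True
  | _, _, .add => True
  | _, _, .scal _ => True
  | _, _, .one => True
  | _, _, .normal => True
  | _, _, .sel => False

/-! ### Semantics: circuits as Markov kernels -/

/-- The values carried by a wire. -/
abbrev Val : Col → Type
  | B => Bool
  | R => ℝ

instance : (a : Col) → MeasurableSpace (Val a)
  | B => (inferInstance : MeasurableSpace Bool)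
  | R => (inferInstance : MeasurableSpace ℝ)

/-- The values carried by a bundle of wires. -/
def Env : List Col → Type
  | [] => Unit
  | a :: v => Val a × Env v

instance instMeasurableSpaceEnv : (v : List Col) → MeasurableSpace (Env v)
  | [] => (inferInstance : MeasurableSpace Unit)
  | a :: v => @Prod.instMeasurableSpace (Val a) (Env v) _ (instMeasurableSpaceEnv v)

/-- Juxtaposition of values. -/
def join : (v w : List Col) → Env v × Env w → Env (v ++ w)
  | [], _, x => x.2
  | _ :: v, w, x => (x.1.1, join v w (x.1.2, x.2))

/-- The inverse of juxtaposition. -/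
def split : (v w : List Col) → Env (v ++ w) → Env v × Env w
  | [], _, x => ((), x)
  | _ :: v, w, x => ((x.1, (split v w x.2).1), (split v w x.2).2)

theorem measurable_join : (v w : List Col) → Measurable (join v w)
  | [], _ => measurable_snd
  | a :: v, w => by
      have h := measurable_join v w
      exact Measurable.prodMk (α := (Val a × Env v) × Env w) (β := Val a)
        (γ := Env (v ++ w)) (measurable_fst.comp measurable_fst)
        (h.comp ((measurable_snd.comp measurable_fst).prodMk measurable_snd))

theorem measurable_split : (v w : List Col) → Measurable (split v w)
  | [], _ => Measurable.prodMk measurable_const measurable_id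
  | a :: v, w => by
      have h := (measurable_split v w).comp
        (measurable_snd : Measurable (Prod.snd : Val a × Env (v ++ w) → Env (v ++ w)))
      exact Measurable.prodMk (α := Val a × Env (v ++ w)) (β := Val a × Env v) (γ := Env w)
        (measurable_fst.prodMk (measurable_fst.comp h)) (measurable_snd.comp h)

/-- The kernel of a measurable function. -/
noncomputable def detK {v w : List Col} (f : Env v → Env w) (hf : Measurable f) :
    Kernel (Env v) (Env w) := Kernel.deterministic f hf

/-- The kernel of a measure (no input wires). -/
noncomputable def constK {w : List Col} (μ : Measure (Env w)) : Kernel (Env []) (Env w) :=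
  Kernel.const (Env []) μ

/-- A truth value on a Boolean wire. -/
def bit (b : Bool) : Env [B] := (b, ())

/-- A number on a real wire. -/
def num (x : ℝ) : Env [R] := (x, ())

theorem measurable_num : Measurable num :=
  show Measurable fun x : ℝ => (x, ()) by fun_prop

/-- The semantics of circuits. -/
noncomputable def sem : {v w : List Col} → Circ v w → Kernel (Env v) (Env w)
  | _, _, .idn _ => Kernel.id
  | _, _, .swap v w =>
      detK (fun x => join w v (split v w x).swap)
        ((measurable_join w v).comp (measurable_swap.comp (measurable_split v w)))
  | _, _, .seq c d => (sem d).comp (sem c)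
  | _, _, @Circ.par v w v' w' c d =>
      (((sem c).parallelComp (sem d)).comap (split v v') (measurable_split v v')).map (join w w')
  | _, _, .del a => detK (v := [a]) (w := []) (fun _ => ()) measurable_const
  | _, _, .copy a =>
      detK (v := [a]) (w := [a, a]) (fun x => (x.1, x.1, ()))
        (show Measurable fun x : Val a × Unit => (x.1, x.1, ()) by fun_prop)
  | _, _, .conj =>
      detK (v := [B, B]) (fun x => bit (x.1 && x.2.1))
        (show Measurable fun x : Bool × Bool × Unit => (x.1 && x.2.1, ()) from .of_discrete)
  | _, _, .neg =>
      detK (v := [B]) (fun x => bit (!x.1))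
        (show Measurable fun x : Bool × Unit => (!x.1, ()) from .of_discrete)
  | _, _, .flip p =>
      constK (ENNReal.ofReal p • Measure.dirac (bit true)
        + ENNReal.ofReal (1 - p) • Measure.dirac (bit false))
  | _, _, .zero => detK (v := []) (fun _ => num 0) measurable_const
  | _, _, .add =>
      detK (v := [R, R]) (fun x => num (x.1 + x.2.1 : ℝ))
        (show Measurable fun x : ℝ × ℝ × Unit => (x.1 + x.2.1, ()) by fun_prop)
  | _, _, .scal k =>
      detK (v := [R]) (fun x => num (k * x.1 : ℝ))
        (show Measurable fun x : ℝ × Unit => (k * x.1, ()) by fun_prop)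
  | _, _, .one => detK (v := []) (fun _ => num 1) measurable_const
  | _, _, .normal => constK ((gaussianReal 0 1).map num)
  | _, _, .sel =>
      detK (v := [B, R, R]) (fun x => num (if x.1 = true then x.2.1 else x.2.2.1))
        (measurable_num.comp <|
          show Measurable fun x : Bool × ℝ × ℝ × Unit => if x.1 = true then x.2.1 else x.2.2.1 from
            .ite (measurable_fst (measurableSet_singleton true)) (by fun_prop) (by fun_prop))

/-- Every circuit denotes a Markov kernel. -/
theorem isMarkovKernel_sem {v w : List Col} (c : Circ v w) : IsMarkovKernel (sem c) := by
  have hdet {v w : List Col} (f : Env v → Env w) (hf : Measurable f) :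
      IsMarkovKernel (detK f hf) := Kernel.isMarkovKernel_deterministic hf
  have hconst {w : List Col} (μ : Measure (Env w)) (hμ : IsProbabilityMeasure μ) :
      IsMarkovKernel (constK μ) := ⟨fun _ => hμ⟩
  induction c with
  | idn v => unfold sem; infer_instance
  | seq c d hc hd => unfold sem; infer_instance
  | @par v w v' w' c d hc hd =>
      unfold sem
      exact Kernel.IsMarkovKernel.map _ (measurable_join w w')
  | flip p =>
      refine hconst _ ⟨?_⟩
      have h : ENNReal.ofReal (p : ℝ) + ENNReal.ofReal (1 - p) = 1 := by
        rw [← ENNReal.ofReal_add p.2.1 (sub_nonneg.2 p.2.2)]; simp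
      rw [Measure.add_apply, Measure.smul_apply, Measure.smul_apply, measure_univ, measure_univ]
      simpa using h
  | normal => exact hconst _ (Measure.isProbabilityMeasure_map measurable_num.aemeasurable)
  | _ => exact hdet _ _

/-! ### The equational theory -/

/-- The laws of strict symmetric monoidal categories. -/
inductive SMCLaw : {v w : List Col} → Circ v w → Circ v w → Prop where
  | idn_seq {v w} (c : Circ v w) : SMCLaw (idn v ⨾ c) c
  | seq_idn {v w} (c : Circ v w) : SMCLaw (c ⨾ idn w) c
  | seq_assoc {u v w x} (c : Circ u v) (d : Circ v w) (e : Circ w x) :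
      SMCLaw ((c ⨾ d) ⨾ e) (c ⨾ (d ⨾ e))
  | par_idn (v w) : SMCLaw (idn v ⊠ idn w) (idn (v ++ w))
  | interchange {u v w u' v' w'} (c : Circ u v) (d : Circ v w) (c' : Circ u' v')
      (d' : Circ v' w') : SMCLaw ((c ⨾ d) ⊠ (c' ⨾ d')) ((c ⊠ c') ⨾ (d ⊠ d'))
  | par_assoc {v w v' w' v'' w''} (c : Circ v w) (d : Circ v' w') (e : Circ v'' w'') :
      SMCLaw (((c ⊠ d) ⊠ e) ⨾ wire (List.append_assoc w w' w''))
        (wire (List.append_assoc v v' v'') ⨾ (c ⊠ (d ⊠ e)))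
  | nil_par {v w} (c : Circ v w) : SMCLaw (idn [] ⊠ c) c
  | par_nil {v w} (c : Circ v w) :
      SMCLaw ((c ⊠ idn []) ⨾ wire (List.append_nil w)) (wire (List.append_nil v) ⨾ c)
  | swap_natural {v w v' w'} (c : Circ v w) (d : Circ v' w') :
      SMCLaw ((c ⊠ d) ⨾ swap w w') (swap v v' ⨾ (d ⊠ c))
  | swap_swap (v w) : SMCLaw (swap v w ⨾ swap w v) (idn (v ++ w))
  | swap_append (u v w) :
      SMCLaw (swap u (v ++ w) ⨾ wire (List.append_assoc v w u))
        (wire (List.append_assoc u v w).symm ⨾ (swap u v ⊠ idn w) ⨾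
          wire (List.append_assoc v u w) ⨾ (idn v ⊠ swap u w))

/-- The real generators that denote deterministic maps and are copied by an axiom. -/
inductive RealDet : {v : List Col} → Circ v [R] → Prop where
  | zero : RealDet zero
  | add : RealDet add
  | scal (k : ℝ) : RealDet (scal k)
  | one : RealDet one

/-- The Boolean generators that denote deterministic maps and are copied by an axiom. -/
inductive BoolDet : {v : List Col} → Circ v [B] → Prop where
  | conj : BoolDet conj
  | neg : BoolDet neg

/-- Two nested layers of if-then-else, which send inputs `a, b, x, y, z, w` to
`if a then (if b then x else y) else (if b then z else w)`. -/
def nested : Circ [B, B, R, R, R, R] [R] :=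
  (idn [B] ⊠ copy B ⊠ idn [R, R, R, R]) ⨾ (idn [B, B] ⊠ swap [B] [R, R] ⊠ idn [R, R]) ⨾
    (idn [B] ⊠ sel ⊠ sel) ⨾ sel

/-- The axioms that are specific to the theory of conditional Gaussian mixtures. -/
inductive Axm : {v w : List Col} → Circ v w → Circ v w → Prop where
  /-- copying is coassociative (for either colour) -/
  | copy_assoc (a : Col) : Axm (copy a ⨾ (copy a ⊠ idn [a])) (copy a ⨾ (idn [a] ⊠ copy a))
  /-- discarding is a left counit of copying -/
  | copy_del_left (a : Col) : Axm (copy a ⨾ (del a ⊠ idn [a])) (idn [a])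
  /-- discarding is a right counit of copying -/
  | copy_del_right (a : Col) : Axm (copy a ⨾ (idn [a] ⊠ del a)) (idn [a])
  /-- copying is cocommutative -/
  | copy_comm (a : Col) : Axm (copy a ⨾ swap [a] [a]) (copy a)
  | real_copy {v} (g : Circ v [R]) (hg : RealDet g) : Axm (g ⨾ copy R) (copyW v ⨾ (g ⊠ g))
  | real_del {v} (g : Circ v [R]) (hg : RealDet g) : Axm (g ⨾ del R) (delW v)
  | normal_del : Axm (normal ⨾ del R) (idn [])
  | bool_copy {v} (g : Circ v [B]) (hg : BoolDet g) : Axm (g ⨾ copy B) (copyW v ⨾ (g ⊠ g))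
  | bool_del {v} (g : Circ v [B]) (hg : BoolDet g) : Axm (g ⨾ del B) (delW v)
  | flip_del (p : unitInterval) : Axm (flip p ⨾ del B) (idn [])
  /-- `if b then (if b then x else y) else z` is `if b then x else z` -/
  | ite_same_left :
      Axm ((copy B ⊠ idn [R, R, R]) ⨾ (idn [B] ⊠ sel ⊠ idn [R]) ⨾ sel)
        ((idn [B] ⊠ idn [R] ⊠ del R ⊠ idn [R]) ⨾ sel)
  /-- `if b then x else (if b then y else z)` is `if b then x else z` -/
  | ite_same_right :
      Axm ((copy B ⊠ idn [R, R, R]) ⨾ (idn [B] ⊠ swap [B] [R] ⊠ idn [R, R]) ⨾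
          (idn [B] ⊠ idn [R] ⊠ sel) ⨾ sel)
        ((idn [B] ⊠ idn [R] ⊠ del R ⊠ idn [R]) ⨾ sel)
  /-- a guard that is true -/
  | ite_true : Axm ((flip 1 ⊠ idn [R, R]) ⨾ sel) (idn [R] ⊠ del R :)
  /-- a guard that is false -/
  | ite_false : Axm ((flip 0 ⊠ idn [R, R]) ⨾ sel) (del R ⊠ idn [R] :)
  /-- `if a then (if b then x else y) else (if b then z else w)` is
  `if b then (if a then x else z) else (if a then y else w)` -/
  | ite_ite : Axm nested ((swap [B] [B] ⊠ idn [R] ⊠ swap [R] [R] ⊠ idn [R]) ⨾ nested)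
  /-- two branches that share a normal sample may take a sample each -/
  | ite_normal {k l n : ℕ} (c : Circ ([R] ++ Rw k) (Rw n)) (d : Circ ([R] ++ Rw l) (Rw n)) :
      Axm
        ((idn [B] ⊠ (normal ⨾ copy R) ⊠ idn (Rw k ++ Rw l)) ⨾
          (idn [B] ⊠ mid [R] [R] (Rw k) (Rw l)) ⨾ (idn [B] ⊠ c ⊠ d) ⨾ selN n)
        ((idn [B] ⊠ (normal ⊠ normal) ⊠ idn (Rw k ++ Rw l)) ⨾
          (idn [B] ⊠ mid [R] [R] (Rw k) (Rw l)) ⨾ (idn [B] ⊠ c ⊠ d) ⨾ selN n)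
  /-- if-then-else is natural -/
  | ite_natural {m n : ℕ} (c : Circ (Rw m) (Rw n)) :
      Axm (selN m ⨾ c) ((idn [B] ⊠ c ⊠ c) ⨾ selN n)
  /-- a negated guard -/
  | ite_neg : Axm ((neg ⊠ idn [R, R]) ⨾ sel) ((idn [B] ⊠ swap [R] [R]) ⨾ sel)
  /-- `if a and b then x else y` is `if a then (if b then x else y) else y` -/
  | ite_conj :
      Axm ((conj ⊠ idn [R, R]) ⨾ sel)
        ((idn [B, B] ⊠ idn [R] ⊠ copy R) ⨾ (idn [B] ⊠ sel ⊠ idn [R]) ⨾ sel)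
  /-- two equal branches -/
  | ite_copy : Axm ((idn [B] ⊠ copy R) ⨾ sel) (del B ⊠ idn [R] :)
  | ite_del : Axm (sel ⨾ del R) (del B ⊠ del R ⊠ del R :)
  /-- skew associativity of convex combinations -/
  | ite_skew (p q p' q' : unitInterval) (hpq : (p * q : ℝ) ≠ 1) (hp' : (p' : ℝ) = p * q)
      (hq' : (q' : ℝ) = q * (1 - p) / (1 - p * q)) :
      Axm ((flip q ⊠ flip p ⊠ idn [R, R, R]) ⨾ (idn [B] ⊠ sel ⊠ idn [R]) ⨾ sel)
        ((flip p' ⊠ idn [R] ⊠ flip q' ⊠ idn [R, R]) ⨾ (idn [B] ⊠ idn [R] ⊠ sel) ⨾ sel)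

/-- Derivable equality in the theory of conditional Gaussian mixtures: the congruence generated
by the laws of strict symmetric monoidal categories, the axioms above, and the equalities of the
Boolean and of the Gaussian fragment. In each of these two fragments, two circuits are equal when
they denote the same Markov kernel. -/
inductive CGM : {v w : List Col} → Circ v w → Circ v w → Prop where
  | smc {v w} {c d : Circ v w} (h : SMCLaw c d) : CGM c d
  | axm {v w} {c d : Circ v w} (h : Axm c d) : CGM c d
  | bool {v w} {c d : Circ v w} (hc : IsBool c) (hd : IsBool d) (h : sem c = sem d) : CGM c d
  | gauss {v w} {c d : Circ v w} (hc : IsGauss c) (hd : IsGauss d) (h : sem c = sem d) : CGM c d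
  | refl {v w} (c : Circ v w) : CGM c c
  | symm {v w} {c d : Circ v w} (h : CGM c d) : CGM d c
  | trans {v w} {c d e : Circ v w} (h : CGM c d) (h' : CGM d e) : CGM c e
  | seq {u v w} {c c' : Circ u v} {d d' : Circ v w} (h : CGM c c') (h' : CGM d d') :
      CGM (c ⨾ d) (c' ⨾ d')
  | par {v w v' w'} {c c' : Circ v w} {d d' : Circ v' w'} (h : CGM c c') (h' : CGM d d') :
      CGM (c ⊠ d) (c' ⊠ d')

/-! ### Normal forms -/

/-- Convex normal form: a Gaussian circuit, or a convex combination, with a weight strictly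
between `0` and `1`, of a Gaussian circuit and a circuit in convex normal form. -/
inductive IsCNF {m n : ℕ} : Circ (Rw m) (Rw n) → Prop where
  | gauss {c : Circ (Rw m) (Rw n)} (hc : IsGauss c) : IsCNF c
  | mix {p : unitInterval} (hp : 0 < p ∧ p < 1) {c d : Circ (Rw m) (Rw n)} (hc : IsGauss c)
      (hd : IsCNF d) : IsCNF (mix p c d)

/-- Normal form: a tree of if-then-else gates guarded by the Boolean inputs, taken in order,
whose leaves are in convex normal form. -/
inductive IsNF {m n : ℕ} : {p : ℕ} → Circ (Bw p ++ Rw m) (Rw n) → Prop where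
  | leaf {c : Circ (Rw m) (Rw n)} (hc : IsCNF c) : IsNF (p := 0) c
  | node {p : ℕ} {c d : Circ (Bw p ++ Rw m) (Rw n)} (hc : IsNF c) (hd : IsNF d) :
      IsNF (p := p + 1) (cond c d)

end MixCirc

/-!
Circuits are studied modulo derivable equality (`Mor`). Copying and discarding make every word of
wires a cocommutative comonoid (`isComon`), and every circuit can be discarded (`seq_dl`). So
circuits with a common input can be paired (`pair`), and those that can be copied (`Det`) behave
like tuples of terms in the input variables.

The key fact is that if-then-else commutes with *every* circuit. If-then-else is extended to
bundles of mixed wires (`cw`), a Boolean wire being chosen by the Boolean circuit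
`(b, x, y) ↦ (b ∧ x) ∨ (¬b ∧ y)`. Naturality then holds for each generator: for the real ones it
is an axiom, for the Boolean ones an equation between Boolean circuits, and for the if-then-else
gate it follows from the laws for nested if-then-else. Since it is stable under both
compositions, it holds in general (`cw_natural`).

Consequently every circuit is a case distinction on its first Boolean input (`condM_inst`): it is
`if b then f₁ else f₀`, where `f₁` and `f₀` arise by feeding in the constants true and false. This
removes the Boolean inputs one at a time, and it remains to treat circuits with real inputs and
outputs only. Another consequence is that convex combinations commute with sequential and
parallel composition (`mixM_seq`, `seq_mixM`, `mixM_par`, `par_mixM`), and that a coin is a convex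
combination of its two constant outcomes (`mixM_inst`).

A circuit with real inputs is then evaluated from its inputs to its outputs, while the values on
the Boolean wires are kept as constants and each coin is turned into a convex combination
(`IsConst.mixG_seq`). A gate with a constant guard selects one of its branches, so a finite
mixture of Gaussian circuits remains. Skew associativity (`mixM_mixM`), which is the equality of
two Boolean circuits with two coins each, brings an arbitrarily nested mixture into convex normal
form (`HasCNF.mixM`).
-/

namespace MixCirc

open Circ Col

variable {u v w x u' v' w' : List Col}

/-! ### Circuits modulo derivable equality -/

/-- Derivable equality as an equivalence relation. -/
def cgmSetoid (v w : List Col) : Setoid (Circ v w) where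
  r := CGM
  iseqv := ⟨CGM.refl, CGM.symm, CGM.trans⟩

/-- Circuits modulo derivable equality. -/
def Mor (v w : List Col) : Type := Quotient (cgmSetoid v w)

/-- The class of a circuit. -/
def mk (c : Circ v w) : Mor v w := Quotient.mk (cgmSetoid v w) c

theorem mk_eq {c d : Circ v w} : mk c = mk d ↔ CGM c d := Quotient.eq (r := cgmSetoid v w)

theorem mk_surjective (f : Mor v w) : ∃ c, mk c = f := Quotient.exists_rep f

/-- Sequential composition of classes. -/
def Mor.seq (f : Mor u v) (g : Mor v w) : Mor u w :=
  Quotient.map₂ Circ.seq (fun _ _ h _ _ h' => CGM.seq h h') f g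

/-- Parallel composition of classes. -/
def Mor.par (f : Mor v w) (g : Mor v' w') : Mor (v ++ v') (w ++ w') :=
  Quotient.map₂ Circ.par (fun _ _ h _ _ h' => CGM.par h h') f g

notation:60 c:61 " ⟫ " d:60 => Mor.seq (c :) (d :)
infixr:70 " ⫴ " => Mor.par

/-- The identity. -/
def one (v : List Col) : Mor v v := mk (idn v)

/-- The identity between equal words. -/
def cast (h : v = w) : Mor v w := mk (wire h)

/-- The symmetry. -/
def sw (v w : List Col) : Mor (v ++ w) (w ++ v) := mk (Circ.swap v w)

theorem mk_seq (c : Circ u v) (d : Circ v w) : mk (c ⨾ d) = mk c ⟫ mk d := rfl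
theorem mk_par (c : Circ v w) (d : Circ v' w') : mk (c ⊠ d) = mk c ⫴ mk d := rfl
theorem mk_idn : mk (idn v) = one v := rfl
theorem mk_swap : mk (Circ.swap v w) = sw v w := rfl
theorem cast_rfl (h : v = v) : cast h = one v := rfl

theorem one_seq (f : Mor v w) : one v ⟫ f = f := by
  obtain ⟨c, rfl⟩ := mk_surjective f
  exact mk_eq.2 (.smc (.idn_seq c))

theorem seq_one (f : Mor v w) : f ⟫ one w = f := by
  obtain ⟨c, rfl⟩ := mk_surjective f
  exact mk_eq.2 (.smc (.seq_idn c))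

theorem seq_assoc (f : Mor u v) (g : Mor v w) (h : Mor w x) : (f ⟫ g) ⟫ h = f ⟫ g ⟫ h := by
  obtain ⟨c, rfl⟩ := mk_surjective f
  obtain ⟨d, rfl⟩ := mk_surjective g
  obtain ⟨e, rfl⟩ := mk_surjective h
  exact mk_eq.2 (.smc (.seq_assoc c d e))

theorem one_par_one (v w : List Col) : one v ⫴ one w = one (v ++ w) :=
  mk_eq.2 (.smc (.par_idn v w))

theorem par_seq_par (f : Mor u v) (g : Mor v w) (f' : Mor u' v') (g' : Mor v' w') :
    (f ⫴ f') ⟫ (g ⫴ g') = (f ⟫ g) ⫴ (f' ⟫ g') := by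
  obtain ⟨c, rfl⟩ := mk_surjective f
  obtain ⟨d, rfl⟩ := mk_surjective g
  obtain ⟨c', rfl⟩ := mk_surjective f'
  obtain ⟨d', rfl⟩ := mk_surjective g'
  exact (mk_eq.2 (.smc (.interchange c d c' d'))).symm

theorem par_assoc {v'' w'' : List Col} (f : Mor v w) (g : Mor v' w') (h : Mor v'' w'') :
    ((f ⫴ g) ⫴ h) ⟫ cast (List.append_assoc w w' w'') =
      cast (List.append_assoc v v' v'') ⟫ (f ⫴ g ⫴ h) := by
  obtain ⟨c, rfl⟩ := mk_surjective f
  obtain ⟨d, rfl⟩ := mk_surjective g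
  obtain ⟨e, rfl⟩ := mk_surjective h
  exact mk_eq.2 (.smc (.par_assoc c d e))

theorem nil_par (f : Mor v w) : one [] ⫴ f = f := by
  obtain ⟨c, rfl⟩ := mk_surjective f
  exact mk_eq.2 (.smc (.nil_par c))

theorem par_nil (f : Mor v w) :
    (f ⫴ one []) ⟫ cast (List.append_nil w) = cast (List.append_nil v) ⟫ f := by
  obtain ⟨c, rfl⟩ := mk_surjective f
  exact mk_eq.2 (.smc (.par_nil c))

theorem par_sw (f : Mor v w) (g : Mor v' w') : (f ⫴ g) ⟫ sw w w' = sw v v' ⟫ (g ⫴ f) := by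
  obtain ⟨c, rfl⟩ := mk_surjective f
  obtain ⟨d, rfl⟩ := mk_surjective g
  exact mk_eq.2 (.smc (.swap_natural c d))

theorem sw_sw (v w : List Col) : sw v w ⟫ sw w v = one (v ++ w) :=
  mk_eq.2 (.smc (.swap_swap v w))

theorem sw_append (u v w : List Col) :
    sw u (v ++ w) ⟫ cast (List.append_assoc v w u) =
      cast (List.append_assoc u v w).symm ⟫ (sw u v ⫴ one w) ⟫
        cast (List.append_assoc v u w) ⟫ (one v ⫴ sw u w) :=
  mk_eq.2 (.smc (.swap_append u v w))

theorem cast_cast (h : u = v) (h' : v = w) : cast h ⟫ cast h' = cast (h.trans h') := by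
  subst h h'; exact one_seq _

theorem cast_seq_symm (h : u = v) (f : Mor u w) : cast h ⟫ cast h.symm ⟫ f = f := by
  subst h; simp only [cast_rfl, one_seq]

theorem cast_symm_seq (h : v = u) (f : Mor u w) : cast h.symm ⟫ cast h ⟫ f = f := by
  subst h; simp only [cast_rfl, one_seq]

theorem cast_par_cast (h : u = v) (h' : u' = v') :
    cast h ⫴ cast h' = cast (congrArg₂ (· ++ ·) h h') := by
  subst h h'; exact one_par_one _ _

theorem cast_par_one (h : u = v) (w : List Col) :
    cast h ⫴ one w = cast (congrArg (· ++ w) h) := by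
  subst h; exact one_par_one _ _

theorem one_par_cast (h : u = v) (w : List Col) :
    one w ⫴ cast h = cast (congrArg (w ++ ·) h) := by
  subst h; exact one_par_one _ _

theorem nil_par_cast (f : Mor v w) :
    (one [] ⫴ f) ⟫ cast (List.nil_append w) = cast (List.nil_append v) ⟫ f := by
  rw [nil_par]; exact (seq_one f).trans (one_seq f).symm

theorem sw_append' (u v w : List Col) :
    cast (List.append_assoc u v w) ⟫ sw u (v ++ w) ⟫ cast (List.append_assoc v w u) =
      (sw u v ⫴ one w) ⟫ cast (List.append_assoc v u w) ⟫ (one v ⫴ sw u w) := by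
  rw [sw_append, cast_seq_symm]

theorem append_sw (u v w : List Col) :
    cast (List.append_assoc u v w).symm ⟫ sw (u ++ v) w ⟫ cast (List.append_assoc w u v).symm =
      (one u ⫴ sw v w) ⟫ cast (List.append_assoc u w v).symm ⟫ (sw u w ⫴ one v) := by
  have cancel {a b c : List Col} {f g : Mor a b} (k : Mor b c) (l : Mor c b)
      (hkl : k ⟫ l = one b) (h : f ⟫ k = g ⟫ k) : f = g := by
    have := congrArg (· ⟫ l) h
    simpa only [seq_assoc, hkl, seq_one] using this
  -- both sides are inverse to the same morphism
  refine cancel (cast (List.append_assoc w u v) ⟫ sw w (u ++ v) ⟫ cast (List.append_assoc u v w))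
    (cast (List.append_assoc u v w).symm ⟫ sw (u ++ v) w ⟫ cast (List.append_assoc w u v).symm)
    ?_ ?_
  · simp only [seq_assoc]
    rw [cast_seq_symm, ← seq_assoc (sw w _), sw_sw, one_seq, cast_cast]; rfl
  · rw [sw_append']
    have e1 {y : List Col} (f : Mor (u ++ (v ++ w)) y) :
        (one u ⫴ sw v w) ⟫ (one u ⫴ sw w v) ⟫ f = f := by
      rw [← seq_assoc, par_seq_par, one_seq, sw_sw, one_par_one, one_seq]
    have e2 {y : List Col} (f : Mor ((u ++ w) ++ v) y) :
        (sw u w ⫴ one v) ⟫ (sw w u ⫴ one v) ⟫ f = f := by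
      rw [← seq_assoc, par_seq_par, one_seq, sw_sw, one_par_one, one_seq]
    simp only [seq_assoc]
    rw [e2, cast_symm_seq, par_seq_par, one_seq, sw_sw, one_par_one, ← sw_append', cast_symm_seq,
      ← seq_assoc (sw _ _), sw_sw, one_seq, cast_cast]
    rfl

theorem cast_pentagon (u v w x : List Col) :
    (cast (List.append_assoc u v w) ⫴ one x) ⟫ cast (List.append_assoc u (v ++ w) x) ⟫
        (one u ⫴ cast (List.append_assoc v w x)) =
      cast (List.append_assoc (u ++ v) w x) ⟫ cast (List.append_assoc u v (w ++ x)) := by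
  rw [cast_par_one, one_par_cast, cast_cast, cast_cast, cast_cast]

theorem cast_triangle (v w : List Col) :
    cast (List.append_assoc v [] w) ⟫ (one v ⫴ cast (List.nil_append w)) =
      cast (List.append_nil v) ⫴ one w := by
  rw [cast_par_one, one_par_cast, cast_cast]

/-! ### Copying and discarding bundles in the symmetric monoidal category of circuits -/

section Category

open CategoryTheory MonoidalCategory

/-- Words as the objects of a category, with circuits modulo derivable equality as morphisms. It is
a symmetric monoidal category, which gives access to the interchange of tensor factors and to
tensor products of comonoids. -/
def Word : Type := List Col

instance : Category Word where
  Hom v w := Mor v w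
  id v := one v
  comp f g := f ⟫ g
  id_comp := one_seq
  comp_id := seq_one
  assoc := seq_assoc

/-- The isomorphism between equal words. -/
def castIso {v w : List Col} (h : v = w) : @Iso Word _ v w where
  hom := cast h
  inv := cast h.symm
  hom_inv_id := cast_cast _ _
  inv_hom_id := cast_cast _ _

-- `List.append` rather than `++`, since `Word` has no `Append` instance
instance : MonoidalCategoryStruct Word where
  tensorObj v w := List.append v w
  whiskerLeft u _ _ f := Mor.par (one u) f
  whiskerRight f w := Mor.par f (one w)
  tensorHom f g := Mor.par f g
  tensorUnit := ([] : List Col)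
  associator u v w := castIso (List.append_assoc u v w)
  leftUnitor v := castIso (List.nil_append v)
  rightUnitor v := castIso (List.append_nil v)

instance : MonoidalCategory Word := MonoidalCategory.ofTensorHom
  (id_tensorHom_id := fun v w => one_par_one v w)
  (id_tensorHom := fun _ _ _ _ => rfl)
  (tensorHom_id := fun _ _ => rfl)
  (tensorHom_comp_tensorHom := fun f f' g g' => par_seq_par f g f' g')
  (associator_naturality := fun f g h => par_assoc f g h)
  (leftUnitor_naturality := fun f => nil_par_cast f)
  (rightUnitor_naturality := fun f => par_nil f)
  (pentagon := cast_pentagon)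
  (triangle := cast_triangle)

instance : BraidedCategory Word where
  braiding v w := ⟨sw v w, sw w v, sw_sw v w, sw_sw w v⟩
  braiding_naturality_right u _ _ f := par_sw (one u) f
  braiding_naturality_left f w := par_sw f (one w)
  hexagon_forward u v w := sw_append' u v w
  hexagon_reverse u v w := append_sw u v w

instance : SymmetricCategory Word where
  symmetry v w := sw_sw v w

end Category

/-- Copying a bundle of wires. -/
def cp (v : List Col) : Mor v (v ++ v) := mk (copyW v)

/-- Discarding a bundle of wires. -/
def dl (v : List Col) : Mor v [] := mk (delW v)

/-- The crossing of the two middle bundles of four. -/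
def md (a b c d : List Col) : Mor ((a ++ b) ++ (c ++ d)) ((a ++ c) ++ (b ++ d)) :=
  mk (mid a b c d)

theorem md_eq_unassoc (a b c d : List Col) : md a b c d =
    cast (List.append_assoc a b (c ++ d)) ⟫ (one a ⫴ cast (List.append_assoc b c d).symm) ⟫
      (one a ⫴ sw b c ⫴ one d) ⟫ (one a ⫴ cast (List.append_assoc c b d)) ⟫
        cast (List.append_assoc a c (b ++ d)).symm := by
  have h (x y : List Col) : (a ++ x) ++ (y ++ d) = a ++ ((x ++ y) ++ d) := by simp
  have e : md a b c d = cast (h b c) ⟫ (one a ⫴ sw b c ⫴ one d) ⟫ cast (h c b).symm := rfl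
  rw [e, one_par_cast, one_par_cast, cast_cast, ← seq_assoc (cast _) (cast _), cast_cast]

theorem dl_singleton (a : Col) : dl [a] = mk (Circ.del a) := by
  have h := par_nil (mk (Circ.del a))
  exact (seq_one _).symm.trans (h.trans (one_seq _))

section Category

open CategoryTheory MonoidalCategory

theorem sw_nil (v : List Col) : sw [] v = cast (List.append_nil v).symm := by
  have h := braiding_tensorUnit_left (C := Word) v
  exact h.trans (one_seq _)

theorem tensorμ_eq_md (a b c d : Word) : tensorμ a b c d = md a b c d :=
  (md_eq_unassoc a b c d).symm

theorem md_assoc (a b c d e f : List Col) :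
    (md a b c d ⫴ one (e ++ f)) ⟫ md (a ++ c) (b ++ d) e f ⟫
        (cast (List.append_assoc a c e) ⫴ cast (List.append_assoc b d f)) =
      cast (List.append_assoc (a ++ b) (c ++ d) (e ++ f)) ⟫ (one (a ++ b) ⫴ md c d e f) ⟫
        md a b (c ++ e) (d ++ f) := by
  have h := tensor_associativity (C := Word) a b c d e f
  -- the statement about `tensorμ` is transported to `md` through an arbitrary family `m₁`, since
  -- the tensor products of words match `++` only up to unfolding
  have key (m₁ : ∀ a b c d : List Col, Mor ((a ++ b) ++ (c ++ d)) ((a ++ c) ++ (b ++ d)))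
      (hm : m₁ = fun a b c d => md a b c d)
      (h : (m₁ a b c d ⫴ one (e ++ f)) ⟫ m₁ (a ++ c) (b ++ d) e f ⟫
        (cast (List.append_assoc a c e) ⫴ cast (List.append_assoc b d f)) =
      cast (List.append_assoc (a ++ b) (c ++ d) (e ++ f)) ⟫ (one (a ++ b) ⫴ m₁ c d e f) ⟫
        m₁ a b (c ++ e) (d ++ f)) := by subst hm; exact h
  exact key (fun a b c d => tensorμ (C := Word) a b c d)
    (by funext a b c d; exact tensorμ_eq_md a b c d) h

theorem par_par_md {a b c d a' b' c' d' : List Col} (f : Mor a a') (g : Mor b b') (h : Mor c c')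
    (k : Mor d d') :
    ((f ⫴ g) ⫴ (h ⫴ k)) ⟫ md a' b' c' d' = md a b c d ⟫ ((f ⫴ h) ⫴ (g ⫴ k)) := by
  have key (m₁ : ∀ a b c d : List Col, Mor ((a ++ b) ++ (c ++ d)) ((a ++ c) ++ (b ++ d)))
      (hm : m₁ = fun a b c d => md a b c d)
      (e : ((f ⫴ g) ⫴ (h ⫴ k)) ⟫ m₁ a' b' c' d' = m₁ a b c d ⟫ ((f ⫴ h) ⫴ (g ⫴ k))) :
      ((f ⫴ g) ⫴ (h ⫴ k)) ⟫ md a' b' c' d' = md a b c d ⟫ ((f ⫴ h) ⫴ (g ⫴ k)) := by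
    subst hm; exact e
  exact key (fun a b c d => tensorμ (C := Word) a b c d)
    (by funext a b c d; exact tensorμ_eq_md a b c d)
    (tensorμ_natural (C := Word) (X₁ := a) (X₂ := b) (Y₁ := a') (Y₂ := b') (U₁ := c) (U₂ := d)
      (V₁ := c') (V₂ := d') f g h k)

/-- The laws of a cocommutative comonoid. -/
structure IsComon (v : List Col) (c : Mor v (v ++ v)) (d : Mor v []) : Prop where
  counit_left : c ⟫ (d ⫴ one v) = one v
  counit_right : c ⟫ (one v ⫴ d) = cast (List.append_nil v).symm
  coassoc : c ⟫ (one v ⫴ c) = c ⟫ (c ⫴ one v) ⟫ cast (List.append_assoc v v v)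
  comm : c ⟫ sw v v = c

/-- The tensor product of two cocommutative comonoids is one, by the corresponding instance for
comonoid objects of a symmetric monoidal category. -/
theorem IsComon.par {v w : List Col} {c : Mor v (v ++ v)} {d : Mor v []} {c' : Mor w (w ++ w)}
    {d' : Mor w []} (h : IsComon v c d) (h' : IsComon w c' d') :
    IsComon (v ++ w) ((c ⫴ c') ⟫ md v v w w) (d ⫴ d') := by
  have key (A B : Word) (i : ComonObj A) (j : ComonObj B) (hi : IsCommComonObj A)
      (hj : IsCommComonObj B) :
      IsComon (A ⊗ B : Word) ((i.comul ⊗ₘ j.comul) ≫ tensorμ A A B B)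
        ((i.counit ⊗ₘ j.counit) ≫ (λ_ (𝟙_ Word)).hom) := by
    rw [← Comon.tensorObj_comul, ← Comon.tensorObj_counit]
    exact ⟨ComonObj.counit_comul (A ⊗ B), ComonObj.comul_counit (A ⊗ B),
      ComonObj.comul_assoc (A ⊗ B), IsCommComonObj.comul_comm (A ⊗ B)⟩
  have h1 := key v w ⟨d, c, h.1, h.2, h.3⟩ ⟨d', c', h'.1, h'.2, h'.3⟩
    (@IsCommComonObj.mk Word _ _ _ v ⟨d, c, h.1, h.2, h.3⟩ h.4)
    (@IsCommComonObj.mk Word _ _ _ w ⟨d', c', h'.1, h'.2, h'.3⟩ h'.4)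
  have e : (tensorμ (C := Word) v v w w) = md v v w w := tensorμ_eq_md v v w w
  have key' (c₁ : Mor ((v ++ v) ++ (w ++ w)) ((v ++ w) ++ (v ++ w))) (hc : c₁ = md v v w w)
      (h : IsComon (v ++ w) ((c ⫴ c') ⟫ c₁) ((d ⫴ d') ⟫ one [])) :
      IsComon (v ++ w) ((c ⫴ c') ⟫ md v v w w) (d ⫴ d') := by
    subst hc
    exact (congrArg (IsComon (v ++ w) _) (seq_one (w := []) (d ⫴ d'))).mp h
  exact key' _ e h1

end Category

/-- Copying and discarding make every bundle of wires a cocommutative comonoid. -/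
theorem isComon (v : List Col) : IsComon v (cp v) (dl v) := by
  induction v with
  | nil => exact ⟨(one_seq _).trans (nil_par _), (one_seq _).trans (nil_par _),
      congrArg (one [] ⟫ ·) (seq_one (one [] ⫴ one [])).symm, (one_seq _).trans (sw_nil [])⟩
  | cons a v ih =>
    have h : IsComon [a] (mk (Circ.copy a)) (mk (Circ.del a)) := by
      refine ⟨mk_eq.2 (.axm (.copy_del_left a)), mk_eq.2 (.axm (.copy_del_right a)), ?_,
        mk_eq.2 (.axm (.copy_comm a))⟩
      refine (mk_eq.2 (.axm (.copy_assoc a))).symm.trans ?_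
      exact congrArg (mk (Circ.copy a) ⟫ ·) (seq_one (mk (Circ.copy a) ⫴ one [a])).symm
    exact h.par ih

theorem md_nil (w : List Col) : md [] [] w w = one (w ++ w) := by
  rw [md_eq_unassoc, sw_nil, one_par_cast, one_par_cast, cast_par_one, one_par_cast,
    cast_cast, cast_cast, cast_cast, cast_cast]
  rfl

theorem cp_append (v w : List Col) : cp (v ++ w) = (cp v ⫴ cp w) ⟫ md v v w w := by
  induction v with
  | nil => exact ((congrArg₂ Mor.seq (nil_par (cp w)) (md_nil w)).trans (seq_one (cp w))).symm
  | cons a v ih =>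
    obtain ⟨k, e1, e2⟩ : ∃ k : Mor [a] ([a] ++ [a]),
        cp ((a :: v) ++ w) = (k ⫴ cp (v ++ w)) ⟫ md [a] [a] (v ++ w) (v ++ w) ∧
        cp (a :: v) = (k ⫴ cp v) ⟫ md [a] [a] v v := ⟨mk (Circ.copy a), rfl, rfl⟩
    have h : (md [a] [a] v v ⫴ one (w ++ w)) ⟫ md (a :: v) (a :: v) w w =
        (one ([a] ++ [a]) ⫴ md v v w w) ⟫ md [a] [a] (v ++ w) (v ++ w) := by
      have h := md_assoc [a] [a] v v w w
      rw [cast_par_cast] at h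
      refine Eq.trans ?_ (h.trans ?_)
      · exact congrArg (_ ⟫ ·) (seq_one (md (a :: v) (a :: v) w w)).symm
      · exact one_seq _
    have h' : (k ⫴ cp v) ⫴ cp w = k ⫴ (cp v ⫴ cp w) := by
      exact (seq_one _).symm.trans ((par_assoc _ _ _).trans (one_seq _))
    calc cp ((a :: v) ++ w)
      _ = (k ⫴ ((cp v ⫴ cp w) ⟫ md v v w w)) ⟫ md [a] [a] (v ++ w) (v ++ w) := by
          rw [e1, ih]
      _ = ((k ⟫ one ([a] ++ [a])) ⫴ ((cp v ⫴ cp w) ⟫ md v v w w)) ⟫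
            md [a] [a] (v ++ w) (v ++ w) := by rw [seq_one]
      _ = (k ⫴ (cp v ⫴ cp w)) ⟫ (one ([a] ++ [a]) ⫴ md v v w w) ⟫
            md [a] [a] (v ++ w) (v ++ w) := by rw [← par_seq_par, seq_assoc]
      _ = ((k ⫴ cp v) ⫴ cp w) ⟫ (md [a] [a] v v ⫴ one (w ++ w)) ⟫
            md (a :: v) (a :: v) w w := by rw [h']; exact congrArg (_ ⟫ ·) h.symm
      _ = _ := by
        rw [← seq_assoc, par_seq_par, seq_one, ← e2]

theorem dl_append (v w : List Col) : dl (v ++ w) = dl v ⫴ dl w := by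
  induction v with
  | nil => exact (nil_par _).symm
  | cons a v ih =>
    have h : (mk (Circ.del a) ⫴ dl v) ⫴ dl w = mk (Circ.del a) ⫴ (dl v ⫴ dl w) :=
      (seq_one _).symm.trans ((par_assoc _ _ _).trans (one_seq _))
    refine Eq.trans ?_ h.symm
    rw [← ih]; rfl

/-! ### Discarding, pairing and projections -/

theorem sw_nil_right (v : List Col) : sw v [] = cast (List.append_nil v) := by
  have h : sw v [] ⟫ sw [] v = cast (List.append_nil v) ⟫ sw [] v := by
    rw [sw_sw, sw_nil, cast_cast, cast_rfl]
  have h' := congrArg (· ⟫ cast (List.append_nil v)) h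
  simp only [seq_assoc] at h'
  rw [sw_nil, cast_cast, cast_rfl, seq_one] at h'
  exact h'.trans (seq_one _)

theorem cp_singleton (a : Col) : cp [a] = mk (Circ.copy a) := by
  have e : md [a] [a] [] [] = one ([a] ++ [a]) := by
    have h := md_eq_unassoc [a] [a] [] []
    rw [sw_nil_right] at h
    simp only [one_par_cast, cast_par_one, cast_cast] at h
    exact h
  have e' : mk (Circ.copy a) ⫴ one [] = mk (Circ.copy a) :=
    (seq_one _).symm.trans ((par_nil _).trans (one_seq _))
  exact (congrArg₂ Mor.seq e' e).trans (seq_one (v := [a]) (w := [a] ++ [a]) _)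

/-- Every circuit can be discarded. -/
theorem seq_dl (f : Mor v w) : f ⟫ dl w = dl v := by
  obtain ⟨c, rfl⟩ := mk_surjective f
  induction c with
  | idn v => exact one_seq _
  | swap v w =>
      rw [mk_swap, dl_append, dl_append, ← par_sw, sw_nil]
      exact seq_one (w := []) _
  | seq c d hc hd => rw [mk_seq, seq_assoc, hd, hc]
  | par c d hc hd => rw [mk_par, dl_append, dl_append, ← hc, ← hd, ← par_seq_par]
  | del a => exact (seq_one _).trans (dl_singleton a).symm
  | copy a =>
      have h := (isComon [a]).counit_left
      rw [cp_singleton] at h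
      have h' : dl [a, a] = (dl [a] ⫴ one [a]) ⟫ dl [a] := by
        have e := par_seq_par (dl [a]) (one []) (one [a]) (dl [a])
        rw [seq_one, one_seq, nil_par] at e
        exact (dl_append [a] [a]).trans e.symm
      rw [h', ← seq_assoc]
      exact (congrArg (· ⟫ dl [a]) h).trans (one_seq _)
  | conj => rw [dl_singleton]; exact mk_eq.2 (.axm (.bool_del _ .conj))
  | neg => exact (congrArg (_ ⟫ ·) (dl_singleton B)).trans (mk_eq.2 (.axm (.bool_del _ .neg)))
  | flip p => rw [dl_singleton]; exact mk_eq.2 (.axm (.flip_del p))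
  | zero => rw [dl_singleton]; exact mk_eq.2 (.axm (.real_del _ .zero))
  | add => rw [dl_singleton]; exact mk_eq.2 (.axm (.real_del _ .add))
  | scal k =>
      exact (congrArg (_ ⟫ ·) (dl_singleton R)).trans (mk_eq.2 (.axm (.real_del _ (.scal k))))
  | one => rw [dl_singleton]; exact mk_eq.2 (.axm (.real_del _ .one))
  | normal => rw [dl_singleton]; exact mk_eq.2 (.axm .normal_del)
  | sel =>
      rw [dl_singleton]
      refine (mk_eq.2 (.axm .ite_del)).trans ?_
      have h : dl [B, R, R] = dl [B] ⫴ dl [R] ⫴ dl [R] := by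
        rw [← dl_append, ← dl_append]; rfl
      rw [h, dl_singleton, dl_singleton]; rfl

/-- Two circuits side by side on copies of the same input. -/
def pair (f : Mor u v) (g : Mor u w) : Mor u (v ++ w) := cp u ⟫ (f ⫴ g)

/-- The projection to the first of two bundles. -/
def fst (v w : List Col) : Mor (v ++ w) v := (one v ⫴ dl w) ⟫ cast (List.append_nil v)

/-- The projection to the second of two bundles. -/
def snd (v w : List Col) : Mor (v ++ w) w := dl v ⫴ one w

theorem pair_seq_par (f : Mor u v) (g : Mor u w) (h : Mor v v') (k : Mor w w') :
    pair f g ⟫ (h ⫴ k) = pair (f ⟫ h) (g ⟫ k) := by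
  rw [pair, pair, seq_assoc, par_seq_par]

theorem pair_fst (f : Mor u v) (g : Mor u w) : pair f g ⟫ fst v w = f := by
  rw [fst, ← seq_assoc, pair_seq_par, seq_dl, seq_one, pair]
  have h : f ⫴ dl u = (one u ⫴ dl u) ⟫ (f ⫴ one []) := by
    rw [par_seq_par, one_seq, seq_one]
  rw [h, ← seq_assoc, (isComon u).counit_right, seq_assoc, par_nil, ← seq_assoc, cast_cast,
    cast_rfl, one_seq]

theorem pair_snd (f : Mor u v) (g : Mor u w) : pair f g ⟫ snd v w = g := by
  have e : pair f g ⟫ (dl v ⫴ one w) = g := by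
    rw [pair_seq_par, seq_dl, seq_one, pair]
    have h : dl u ⫴ g = (dl u ⫴ one u) ⟫ (one [] ⫴ g) := by
      rw [par_seq_par, one_seq, seq_one]
    rw [h, ← seq_assoc, (isComon u).counit_left, nil_par]
    exact one_seq _
  exact e

theorem pair_sw (f : Mor u v) (g : Mor u w) : pair f g ⟫ sw v w = pair g f := by
  rw [pair, seq_assoc, par_sw, ← seq_assoc, (isComon u).comm, pair]

theorem pair_assoc (f : Mor u v) (g : Mor u w) (h : Mor u x) :
    pair (pair f g) h ⟫ cast (List.append_assoc v w x) = pair f (pair g h) := by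
  have e1 : pair (pair f g) h = cp u ⟫ (cp u ⫴ one u) ⟫ ((f ⫴ g) ⫴ h) := by
    rw [par_seq_par, one_seq]; rfl
  have e2 : pair f (pair g h) = cp u ⟫ (one u ⫴ cp u) ⟫ (f ⫴ g ⫴ h) := by
    rw [par_seq_par, one_seq]; rfl
  rw [e1, e2, seq_assoc, seq_assoc, par_assoc, ← seq_assoc (cp u) (one u ⫴ cp u),
    (isComon u).coassoc, seq_assoc, seq_assoc]

theorem pair_assoc_symm (f : Mor u v) (g : Mor u w) (h : Mor u x) :
    pair f (pair g h) ⟫ cast (List.append_assoc v w x).symm = pair (pair f g) h := by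
  rw [← pair_assoc, seq_assoc, cast_cast, cast_rfl, seq_one]

theorem pair_md {a b c d : List Col} (f : Mor u a) (g : Mor u b) (h : Mor u c) (k : Mor u d) :
    pair (pair f g) (pair h k) ⟫ md a b c d = pair (pair f h) (pair g k) := by
  rw [md_eq_unassoc]
  simp only [← seq_assoc]
  simp only [pair_assoc, pair_seq_par, pair_assoc_symm, pair_sw, seq_one]

theorem pair_one_one : pair (one v) (one v) = cp v := by
  rw [pair, one_par_one, seq_one]

/-! ### Deterministic circuits -/

/-- Deterministic circuits: those that can be copied. -/
def Det (f : Mor v w) : Prop := f ⟫ cp w = pair f f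

theorem Det.seq_pair {f : Mor u v} (hf : Det f) (g : Mor v w) (h : Mor v w') :
    f ⟫ pair g h = pair (f ⟫ g) (f ⟫ h) := by
  rw [pair, ← seq_assoc, hf, pair_seq_par]

theorem det_one (v : List Col) : Det (one v) := by
  rw [Det, one_seq, pair_one_one]

theorem det_cast (h : v = w) : Det (cast h) := by
  subst h; exact det_one v

theorem eq_dl (f : Mor v []) : f = dl v := (seq_one f).symm.trans (seq_dl f)

theorem det_dl (v : List Col) : Det (dl v) := (eq_dl _).trans (eq_dl _).symm

theorem Det.seq {f : Mor u v} {g : Mor v w} (hf : Det f) (hg : Det g) : Det (f ⟫ g) := by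
  rw [Det, seq_assoc, hg, hf.seq_pair]

theorem Det.pair {f : Mor u v} {g : Mor u w} (hf : Det f) (hg : Det g) : Det (pair f g) := by
  rw [Det, cp_append, ← seq_assoc, pair_seq_par, hf, hg, pair_md]

theorem Det.par {f : Mor v w} {g : Mor v' w'} (hf : Det f) (hg : Det g) : Det (f ⫴ g) := by
  rw [Det, cp_append, ← seq_assoc, par_seq_par, hf, hg, MixCirc.pair, MixCirc.pair, MixCirc.pair,
    ← par_seq_par, seq_assoc, par_par_md, cp_append, seq_assoc]

theorem det_fst (v w : List Col) : Det (fst v w) :=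
  ((det_one v).par (det_dl w)).seq (det_cast _)

theorem det_snd (v w : List Col) : Det (snd v w) := (det_dl v).par (det_one w)

/-- The two projections of a bundle, paired, give back the bundle: with this, circuits can be
treated as terms in variables. -/
theorem pair_fst_snd (v w : List Col) : pair (fst v w) (snd v w) = one (v ++ w) := by
  have h : md v [] [] w = cast (by simp) := by
    rw [md_eq_unassoc, sw_nil]
    simp only [one_par_cast, cast_par_one, cast_cast]
  have e : pair (fst v w) (dl v ⫴ one w) = one (v ++ w) := by
    have e1 : fst v w ⫴ (dl v ⫴ one w) =
        ((one v ⫴ dl w) ⫴ (dl v ⫴ one w)) ⟫ (cast (List.append_nil v) ⫴ one ([] ++ w)) := by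
      rw [par_seq_par, seq_one, fst]
    rw [MixCirc.pair, e1, cp_append, seq_assoc, ← seq_assoc (md v v w w), ← par_par_md, seq_assoc,
      ← seq_assoc, par_seq_par, (isComon v).counit_right, (isComon w).counit_left, h]
    simp only [cast_par_one, cast_cast]
    rfl
  exact e

theorem pair_eta (f : Mor u (v ++ w)) (hf : Det f) : pair (f ⟫ fst v w) (f ⟫ snd v w) = f := by
  rw [← hf.seq_pair, pair_fst_snd, seq_one]

theorem par_eq_pair (f : Mor v w) (g : Mor v' w') :
    f ⫴ g = pair (fst v v' ⟫ f) (snd v v' ⟫ g) := by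
  rw [← pair_seq_par, pair_fst_snd, one_seq]

theorem sw_eq_pair (v w : List Col) : sw v w = pair (snd v w) (fst v w) := by
  rw [← pair_sw, pair_fst_snd, one_seq]

theorem det_sw (v w : List Col) : Det (sw v w) := by
  rw [sw_eq_pair]; exact (det_snd v w).pair (det_fst v w)

theorem det_cp (v : List Col) : Det (cp v) := by
  rw [← pair_one_one]; exact (det_one v).pair (det_one v)

/-! ### If-then-else on a single real wire -/

theorem pair_assoc_single {a : Col} (f : Mor u [a]) (g : Mor u v) (h : Mor u w) :
    (pair f (pair g h) : Mor u ([a] ++ (v ++ w))) = (pair (pair f g) h : Mor u (([a] ++ v) ++ w)) :=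
  (pair_assoc f g h).symm.trans (seq_one _)

theorem pair_dl (f : Mor u v) : pair f (dl u) = f ⟫ cast (List.append_nil v).symm := by
  have h := pair_fst f (dl u)
  have e : fst v [] = cast (List.append_nil v) := by
    have : one v ⫴ dl [] = one (v ++ []) := one_par_one v []
    rw [fst, this, one_seq]
  rw [e] at h
  conv_rhs => rw [← h]
  rw [seq_assoc, cast_cast, cast_rfl, seq_one]

theorem nil_pair (f : Mor u []) (g : Mor u v) : (pair f g : Mor u v) = g := by
  have h := pair_snd f g
  have e : snd [] v = one ([] ++ v) := one_par_one [] v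
  rw [e] at h
  exact (seq_one _).symm.trans h

/-- The if-then-else gate. -/
def selC : Mor ([B] ++ ([R] ++ [R])) [R] := mk sel

/-- If-then-else on one real wire. -/
def iteR (b : Mor u [B]) (x y : Mor u [R]) : Mor u [R] := pair b (pair x y) ⟫ selC

/-- The negation of a truth value. -/
def notB (b : Mor u [B]) : Mor u [B] := b ⟫ mk neg

/-- The conjunction of two truth values. -/
def andB (a b : Mor u [B]) : Mor u [B] := pair a b ⟫ (mk conj : Mor ([B] ++ [B]) [B])

theorem iteR_same_left {b : Mor u [B]} (hb : Det b) (x y z : Mor u [R]) :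
    iteR b (iteR b x y) z = iteR b x z := by
  have ax : mk ((Circ.copy B ⊠ idn [R, R, R]) ⨾ (idn [B] ⊠ sel ⊠ idn [R]) ⨾ sel) =
    mk ((idn [B] ⊠ idn [R] ⊠ Circ.del R ⊠ idn [R]) ⨾ sel) := mk_eq.2 (.axm .ite_same_left)
  have h1 : pair b (pair x (pair y z)) ⟫ (cp [B] ⫴ one ([R] ++ ([R] ++ [R]))) =
      (pair b (pair (pair b (pair x y)) z) : Mor u ([B] ++ (([B] ++ ([R] ++ [R])) ++ [R]))) := by
    rw [pair_seq_par, hb, seq_one, ← pair_assoc_single]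
    refine congrArg (pair b) ?_
    rw [← pair_assoc_single]
    exact congrArg (pair b) (pair_assoc_single _ _ _)
  have h2 : pair b (pair x (pair y z)) ⟫ (one [B] ⫴ (one [R] ⫴ (dl [R] ⫴ one [R]))) =
      (pair b (pair x z)) := by
    rw [pair_seq_par, pair_seq_par, seq_one, seq_one]
    exact congrArg (fun t => pair b (pair x t)) (pair_snd y z)
  calc iteR b (iteR b x y) z
    _ = pair b (pair (pair b (pair x y)) z) ⟫ (one [B] ⫴ (selC ⫴ one [R])) ⟫ selC := by
        rw [← seq_assoc, pair_seq_par, pair_seq_par, seq_one, seq_one]; rfl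
    _ = pair b (pair x (pair y z)) ⟫ (cp [B] ⫴ one ([R] ++ ([R] ++ [R]))) ⟫
          ((one [B] ⫴ (selC ⫴ one [R])) ⟫ selC) := by rw [← h1]; exact seq_assoc _ _ _
    _ = pair b (pair x (pair y z)) ⟫ (one [B] ⫴ (one [R] ⫴ (dl [R] ⫴ one [R]))) ⟫ selC := by
        rw [cp_singleton, dl_singleton]
        exact congrArg (pair b (pair x (pair y z)) ⟫ ·) ax
    _ = iteR b x z := by rw [← seq_assoc, h2]; rfl

theorem iteR_same_right {b : Mor u [B]} (hb : Det b) (x y z : Mor u [R]) :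
    iteR b x (iteR b y z) = iteR b x z := by
  have ax : mk ((Circ.copy B ⊠ idn [R, R, R]) ⨾ (idn [B] ⊠ swap [B] [R] ⊠ idn [R, R]) ⨾
          (idn [B] ⊠ idn [R] ⊠ sel) ⨾ sel) =
    mk ((idn [B] ⊠ idn [R] ⊠ Circ.del R ⊠ idn [R]) ⨾ sel) := mk_eq.2 (.axm .ite_same_right)
  have h1 : pair b (pair x (pair y z)) ⟫ (cp [B] ⫴ one ([R] ++ ([R] ++ [R]))) =
      (pair b (pair (pair b x) (pair y z)) : Mor u ([B] ++ (([B] ++ [R]) ++ ([R] ++ [R])))) := by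
    rw [pair_seq_par, hb, seq_one, ← pair_assoc_single]
    exact congrArg (pair b) (pair_assoc_single _ _ _)
  have h2 : pair b (pair x (pair y z)) ⟫ (one [B] ⫴ (one [R] ⫴ (dl [R] ⫴ one [R]))) =
      (pair b (pair x z)) := by
    rw [pair_seq_par, pair_seq_par, seq_one, seq_one]
    exact congrArg (fun t => pair b (pair x t)) (pair_snd y z)
  have h3 : pair b (pair (pair b x) (pair y z)) ⟫ (one [B] ⫴ (sw [B] [R] ⫴ one ([R] ++ [R]))) =
      (pair b (pair x (pair b (pair y z))) : Mor u ([B] ++ ([R] ++ ([B] ++ ([R] ++ [R]))))) := by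
    rw [pair_seq_par, pair_seq_par, seq_one, seq_one, pair_sw]
    exact congrArg (pair b) (pair_assoc_single x b (pair y z)).symm
  calc iteR b x (iteR b y z)
    _ = pair b (pair x (pair b (pair y z))) ⟫ (one [B] ⫴ (one [R] ⫴ selC)) ⟫ selC := by
        rw [← seq_assoc, pair_seq_par, pair_seq_par, seq_one, seq_one]; rfl
    _ = pair b (pair (pair b x) (pair y z)) ⟫ (one [B] ⫴ (sw [B] [R] ⫴ one ([R] ++ [R]))) ⟫
          ((one [B] ⫴ (one [R] ⫴ selC)) ⟫ selC) := by rw [← h3]; exact seq_assoc _ _ _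
    _ = pair b (pair x (pair y z)) ⟫ (cp [B] ⫴ one ([R] ++ ([R] ++ [R]))) ⟫
          ((one [B] ⫴ (sw [B] [R] ⫴ one ([R] ++ [R]))) ⟫ (one [B] ⫴ (one [R] ⫴ selC)) ⟫ selC) := by
        rw [← h1]; exact seq_assoc _ _ _
    _ = pair b (pair x (pair y z)) ⟫ (one [B] ⫴ (one [R] ⫴ (dl [R] ⫴ one [R]))) ⟫ selC := by
        rw [cp_singleton, dl_singleton]
        exact congrArg (pair b (pair x (pair y z)) ⟫ ·) ax
    _ = iteR b x z := by rw [← seq_assoc, h2]; rfl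

theorem iteR_notB (b : Mor u [B]) (x y : Mor u [R]) : iteR (notB b) x y = iteR b y x := by
  have ax : mk ((neg ⊠ idn [R, R]) ⨾ sel) = mk ((idn [B] ⊠ swap [R] [R]) ⨾ sel) :=
    mk_eq.2 (.axm .ite_neg)
  calc iteR (notB b) x y
    _ = pair b (pair x y) ⟫ (mk neg ⫴ one ([R] ++ [R])) ⟫ selC := by
        rw [← seq_assoc, pair_seq_par, seq_one]; rfl
    _ = pair b (pair x y) ⟫ (one [B] ⫴ sw [R] [R]) ⟫ selC :=
        congrArg (pair b (pair x y) ⟫ ·) ax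
    _ = iteR b y x := by rw [← seq_assoc, pair_seq_par, seq_one, pair_sw]; rfl

theorem iteR_andB (a b : Mor u [B]) (x : Mor u [R]) {y : Mor u [R]} (hy : Det y) :
    iteR (andB a b) x y = iteR a (iteR b x y) y := by
  have ax : mk ((conj ⊠ idn [R, R]) ⨾ sel) =
    mk ((idn [B, B] ⊠ idn [R] ⊠ Circ.copy R) ⨾ (idn [B] ⊠ sel ⊠ idn [R]) ⨾ sel) :=
    mk_eq.2 (.axm .ite_conj)
  have h1 : pair (pair a b) (pair x y) ⟫ (one ([B] ++ [B]) ⫴ (one [R] ⫴ cp [R])) =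
      (pair a (pair (pair b (pair x y)) y) : Mor u ([B] ++ (([B] ++ ([R] ++ [R])) ++ [R]))) := by
    rw [pair_seq_par, pair_seq_par, hy, seq_one, seq_one, ← pair_assoc_single]
    refine congrArg (pair a) ?_
    rw [← pair_assoc_single]
    exact congrArg (pair b) (pair_assoc_single _ _ _)
  calc iteR (andB a b) x y
    _ = pair (pair a b) (pair x y) ⟫ ((mk conj : Mor ([B] ++ [B]) [B]) ⫴ one ([R] ++ [R])) ⟫
          selC := by
        rw [← seq_assoc, pair_seq_par, seq_one]; rfl
    _ = pair (pair a b) (pair x y) ⟫ (one ([B] ++ [B]) ⫴ (one [R] ⫴ cp [R])) ⟫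
          (one [B] ⫴ (selC ⫴ one [R])) ⟫ selC := by
        rw [cp_singleton]
        exact congrArg (pair (pair a b) (pair x y) ⟫ ·) ax
    _ = pair a (pair (pair b (pair x y)) y) ⟫ (one [B] ⫴ (selC ⫴ one [R])) ⟫ selC := by
        rw [← h1]; exact (seq_assoc _ _ _).symm
    _ = iteR a (iteR b x y) y := by
        rw [← seq_assoc, pair_seq_par, pair_seq_par, seq_one, seq_one]; rfl

theorem iteR_self (b : Mor u [B]) {x : Mor u [R]} (hx : Det x) : iteR b x x = x := by
  have ax : mk ((idn [B] ⊠ Circ.copy R) ⨾ sel) = mk (Circ.del B ⊠ idn [R] :) :=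
    mk_eq.2 (.axm .ite_copy)
  calc iteR b x x
    _ = pair b x ⟫ (one [B] ⫴ cp [R]) ⟫ selC := by
        rw [← seq_assoc, pair_seq_par, seq_one, hx]; rfl
    _ = pair b x ⟫ (dl [B] ⫴ one [R]) := by
        rw [cp_singleton, dl_singleton]
        exact congrArg (pair b x ⟫ ·) ax
    _ = x := pair_snd b x

theorem iteR_flip_one (x y : Mor u [R]) : iteR (dl u ⟫ mk (flip 1)) x y = x := by
  have ax : mk ((flip 1 ⊠ idn [R, R]) ⨾ sel) = mk (idn [R] ⊠ Circ.del R :) :=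
    mk_eq.2 (.axm .ite_true)
  calc iteR (dl u ⟫ mk (flip 1)) x y
    _ = pair (dl u) (pair x y) ⟫ (mk (flip 1) ⫴ one ([R] ++ [R])) ⟫ selC := by
        rw [← seq_assoc, pair_seq_par, seq_one]; rfl
    _ = pair x y ⟫ fst [R] [R] := by
        refine (congrArg₂ Mor.seq (nil_pair (dl u) (pair x y)) ax).trans ?_
        rw [fst, dl_singleton]
        exact congrArg (pair x y ⟫ ·) (seq_one _).symm
    _ = x := pair_fst x y

theorem iteR_flip_zero (x y : Mor u [R]) : iteR (dl u ⟫ mk (flip 0)) x y = y := by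
  have ax : mk ((flip 0 ⊠ idn [R, R]) ⨾ sel) = mk (Circ.del R ⊠ idn [R] :) :=
    mk_eq.2 (.axm .ite_false)
  calc iteR (dl u ⟫ mk (flip 0)) x y
    _ = pair (dl u) (pair x y) ⟫ (mk (flip 0) ⫴ one ([R] ++ [R])) ⟫ selC := by
        rw [← seq_assoc, pair_seq_par, seq_one]; rfl
    _ = pair x y ⟫ snd [R] [R] := by
        refine (congrArg₂ Mor.seq (nil_pair (dl u) (pair x y)) ax).trans ?_
        rw [snd, dl_singleton]; rfl
    _ = y := pair_snd x y

/-- The circuit `nested` as a term. -/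
theorem mk_nested {a b : Mor u [B]} (hb : Det b) (x y z w : Mor u [R]) :
    pair (pair a b) (pair (pair x y) (pair z w)) ⟫ mk nested =
      iteR a (iteR b x y) (iteR b z w) := by
  have h1 : pair (pair a b) (pair (pair x y) (pair z w)) =
      (pair a (pair b (pair x (pair y (pair z w)))) :
        Mor u ([B] ++ ([B] ++ ([R] ++ ([R] ++ ([R] ++ [R])))))) := by
    rw [← pair_assoc_single]
    exact congrArg (fun t => pair a (pair b t)) (pair_assoc_single x y (pair z w)).symm
  have h2 : pair a (pair b (pair x (pair y (pair z w)))) ⟫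
      (one [B] ⫴ (cp [B] ⫴ one ([R] ++ ([R] ++ ([R] ++ [R]))))) =
      (pair (pair a b) (pair (pair b (pair x y)) (pair z w)) :
        Mor u (([B] ++ [B]) ++ (([B] ++ ([R] ++ [R])) ++ ([R] ++ [R])))) := by
    rw [pair_seq_par, pair_seq_par, seq_one, seq_one, hb]
    refine Eq.trans ?_ (pair_assoc_single a b _)
    refine congrArg (pair a) ((pair_assoc_single b b _).symm.trans ?_)
    refine congrArg (pair b) (Eq.trans ?_ (pair_assoc_single b (pair x y) _))
    exact congrArg (pair b) (pair_assoc_single x y _)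
  have h3 : pair (pair a b) (pair (pair b (pair x y)) (pair z w)) ⟫
      (one ([B] ++ [B]) ⫴ (sw [B] ([R] ++ [R]) ⫴ one ([R] ++ [R]))) =
      (pair a (pair (pair b (pair x y)) (pair b (pair z w))) :
        Mor u ([B] ++ (([B] ++ ([R] ++ [R])) ++ ([B] ++ ([R] ++ [R]))))) := by
    rw [pair_seq_par, pair_seq_par, seq_one, seq_one, pair_sw]
    refine (pair_assoc_single a b _).symm.trans ?_
    refine congrArg (pair a) (Eq.trans ?_ (pair_assoc_single b (pair x y) _))
    refine congrArg (pair b) ?_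
    exact (seq_one _).symm.trans (pair_assoc (pair x y) b (pair z w))
  calc pair (pair a b) (pair (pair x y) (pair z w)) ⟫ mk nested
    _ = pair a (pair b (pair x (pair y (pair z w)))) ⟫
          (one [B] ⫴ (cp [B] ⫴ one ([R] ++ ([R] ++ ([R] ++ [R]))))) ⟫
          (one ([B] ++ [B]) ⫴ (sw [B] ([R] ++ [R]) ⫴ one ([R] ++ [R]))) ⟫
          (one [B] ⫴ (selC ⫴ selC)) ⟫ selC := by
        rw [cp_singleton]
        exact congrArg (· ⟫ mk nested) h1
    _ = pair (pair a b) (pair (pair b (pair x y)) (pair z w)) ⟫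
          (one ([B] ++ [B]) ⫴ (sw [B] ([R] ++ [R]) ⫴ one ([R] ++ [R]))) ⟫
          (one [B] ⫴ (selC ⫴ selC)) ⟫ selC := by
        rw [← h2]; exact (seq_assoc _ _ _).symm
    _ = pair a (pair (pair b (pair x y)) (pair b (pair z w))) ⟫ (one [B] ⫴ (selC ⫴ selC)) ⟫
          selC := by
        rw [← h3]; exact (seq_assoc _ _ _).symm
    _ = iteR a (iteR b x y) (iteR b z w) := by
        rw [← seq_assoc, pair_seq_par, pair_seq_par, seq_one]; rfl

theorem iteR_iteR {a b : Mor u [B]} (ha : Det a) (hb : Det b) (x y z w : Mor u [R]) :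
    iteR a (iteR b x y) (iteR b z w) = iteR b (iteR a x z) (iteR a y w) := by
  have ax : mk nested = mk ((swap [B] [B] ⊠ idn [R] ⊠ swap [R] [R] ⊠ idn [R]) ⨾ nested) :=
    mk_eq.2 (.axm .ite_ite)
  have h : pair (pair a b) (pair (pair x y) (pair z w)) ⟫
      (sw [B] [B] ⫴ (one [R] ⫴ (sw [R] [R] ⫴ one [R]))) =
      (pair (pair b a) (pair (pair x z) (pair y w)) :
        Mor u (([B] ++ [B]) ++ (([R] ++ [R]) ++ ([R] ++ [R])))) := by
    have e : pair (pair x y) (pair z w) = (pair x (pair (pair y z) w) :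
        Mor u ([R] ++ (([R] ++ [R]) ++ [R]))) :=
      (pair_assoc_single x y (pair z w)).symm.trans
        (congrArg (pair x) (pair_assoc_single y z w))
    refine (congrArg (fun t => pair (pair a b) t ⟫
      (sw [B] [B] ⫴ (one [R] ⫴ (sw [R] [R] ⫴ one [R])))) e).trans ?_
    rw [pair_seq_par, pair_seq_par, pair_seq_par, seq_one, seq_one, pair_sw, pair_sw]
    refine congrArg (pair (pair b a)) ?_
    exact (congrArg (pair x) (pair_assoc_single z y w).symm).trans
      (pair_assoc_single x z (pair y w))
  rw [← mk_nested hb, ← mk_nested ha, ← h, seq_assoc]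
  exact congrArg (pair (pair a b) (pair (pair x y) (pair z w)) ⟫ ·) ax

/-- If-then-else with a guard that is itself an if-then-else of truth values, the latter being
expressed by conjunction and negation. -/
theorem iteR_choice {b a a' : Mor u [B]} (hb : Det b) (ha : Det a) (ha' : Det a')
    {x y : Mor u [R]} (hx : Det x) (hy : Det y) (hs : Det selC) :
    iteR (notB (andB (notB (andB b a)) (notB (andB (notB b) a')))) x y =
      iteR b (iteR a x y) (iteR a' x y) := by
  have hz {c : Mor u [B]} {p q : Mor u [R]} (hc : Det c) (hp : Det p) (hq : Det q) :
      Det (iteR c p q) := (hc.pair (hp.pair hq)).seq hs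
  have e : iteR (notB (andB (notB b) a')) y x = iteR b y (iteR a' x y) := by
    rw [iteR_notB, iteR_andB _ _ _ hy, iteR_notB]
  rw [iteR_notB, iteR_andB _ _ _ hx, e, iteR_notB,
    iteR_andB _ _ _ (hz hb hy (hz ha' hx hy)), iteR_same_right hb]
  -- the test of `b` is pulled out in front of the test of `a`
  have e2 : iteR a x (iteR b y (iteR a' x y)) =
      iteR b (iteR a x y) (iteR a x (iteR a' x y)) := by
    exact (congrArg (fun t => iteR a t _) (iteR_self b hx).symm).trans (iteR_iteR ha hb _ _ _ _)
  rw [e2, iteR_same_left hb]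

/-! ### Deterministic Boolean circuits and their evaluation -/

/-- Boolean circuits whose only coins are `flip 1`. They denote functions, and the constant true is
available. -/
def IsPlain : {v w : List Col} → Circ v w → Prop
  | _, _, .idn v => ∀ a ∈ v, a = B
  | _, _, .swap v w => ∀ a ∈ v ++ w, a = B
  | _, _, .seq c d => IsPlain c ∧ IsPlain d
  | _, _, .par c d => IsPlain c ∧ IsPlain d
  | _, _, .del a => a = B
  | _, _, .copy a => a = B
  | _, _, .conj => True
  | _, _, .neg => True
  | _, _, .flip p => p = 1
  | _, _, .zero => False
  | _, _, .add => False
  | _, _, .scal _ => False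
  | _, _, .one => False
  | _, _, .normal => False
  | _, _, .sel => False

/-- The function computed by a plain Boolean circuit. On circuits that are not plain, the value is
immaterial. -/
noncomputable def ev : {v w : List Col} → Circ v w → Env v → Env w
  | _, _, .idn _ => fun x => x
  | _, _, .swap v w => fun x => join w v (split v w x).swap
  | _, _, .seq c d => fun x => ev d (ev c x)
  | _, _, @Circ.par v w v' w' c d => fun x =>
      join w w' (ev c (split v v' x).1, ev d (split v v' x).2)
  | _, _, .del _ => fun _ => ()
  | _, _, .copy _ => fun x => (x.1, x.1, ())
  | _, _, .conj => fun x => bit (x.1 && x.2.1)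
  | _, _, .neg => fun x => bit (!x.1)
  | _, _, .flip _ => fun _ => bit true
  | _, _, .zero => fun _ => num 0
  | _, _, .add => fun _ => num 0
  | _, _, .scal _ => fun _ => num 0
  | _, _, .one => fun _ => num 0
  | _, _, .normal => fun _ => num 0
  | _, _, .sel => fun _ => num 0

theorem sem_flip_one : sem (flip 1) = detK (v := []) (fun _ => bit true) measurable_const := by
  ext x : 1
  simp [sem, constK, detK, Kernel.deterministic_apply]

theorem IsPlain.isBool {c : Circ v w} (hc : IsPlain c) : IsBool c := by
  induction c with
  | seq c d ihc ihd => exact ⟨ihc hc.1, ihd hc.2⟩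
  | par c d ihc ihd => exact ⟨ihc hc.1, ihd hc.2⟩
  | flip p => trivial
  | _ => exact hc

theorem IsPlain.sem_eq {c : Circ v w} (hc : IsPlain c) : ∃ h, sem c = detK (ev c) h := by
  induction c with
  | idn v => exact ⟨measurable_id, rfl⟩
  | swap v w => exact ⟨_, rfl⟩
  | seq c d ihc ihd =>
      obtain ⟨h, e⟩ := ihc hc.1
      obtain ⟨h', e'⟩ := ihd hc.2
      refine ⟨h'.comp h, ?_⟩
      rw [sem, e, e']
      exact Kernel.deterministic_comp_deterministic h h'
  | @par v w v' w' c d ihc ihd =>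
      obtain ⟨h, e⟩ := ihc hc.1
      obtain ⟨h', e'⟩ := ihd hc.2
      have hm : Measurable (Prod.map (ev c) (ev d)) := h.prodMap h'
      refine ⟨(measurable_join w w').comp (hm.comp (measurable_split v v')), ?_⟩
      rw [sem, e, e']
      unfold detK
      rw [Kernel.deterministic_parallelComp_deterministic]
      ext x : 1
      rw [Kernel.map_apply _ (measurable_join w w'), Kernel.comap_apply, Kernel.deterministic_apply,
        Measure.map_dirac' (measurable_join w w')]
      exact (Kernel.deterministic_apply
        ((measurable_join w w').comp (hm.comp (measurable_split v v'))) x).symm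
  | del a => exact ⟨_, rfl⟩
  | copy a => exact ⟨_, rfl⟩
  | conj => exact ⟨_, rfl⟩
  | neg => exact ⟨_, rfl⟩
  | flip p => cases hc; exact ⟨_, sem_flip_one⟩
  | zero => exact hc.elim
  | add => exact hc.elim
  | scal k => exact hc.elim
  | one => exact hc.elim
  | normal => exact hc.elim
  | sel => exact hc.elim

/-- Plain circuits with the same truth table are equal. -/
theorem mk_eq_of_ev {c d : Circ v w} (hc : IsPlain c) (hd : IsPlain d) (h : ∀ x, ev c x = ev d x) :
    mk c = mk d := by
  obtain ⟨m, e⟩ := hc.sem_eq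
  obtain ⟨m', e'⟩ := hd.sem_eq
  refine mk_eq.2 (.bool hc.isBool hd.isBool ?_)
  rw [e, e']
  exact Kernel.deterministic_congr (funext h)

theorem isPlain_wire (h : v = w) (hv : ∀ a ∈ v, a = B) : IsPlain (wire h) := by
  subst h; exact hv

theorem sem_par_apply (c : Circ v w) (d : Circ v' w') (x : Env (v ++ v')) :
    sem (c ⊠ d) x =
      ((sem c (split v v' x).1).prod (sem d (split v v' x).2)).map (join w w') := by
  have := isMarkovKernel_sem c
  have := isMarkovKernel_sem d
  rw [sem, Kernel.map_apply _ (measurable_join w w'), Kernel.comap_apply, Kernel.parallelComp_apply]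

theorem sem_seq_plain_apply (c : Circ u v) {d : Circ v w} (hd : IsPlain d) (x : Env u) :
    ∃ _ : Measurable (ev d), sem (c ⨾ d) x = (sem c x).map (ev d) := by
  obtain ⟨m, e⟩ := hd.sem_eq
  refine ⟨m, ?_⟩
  rw [sem, e, detK, Kernel.deterministic_comp_eq_map m, Kernel.map_apply _ m]

theorem map_four_dirac {α β : Type*} [MeasurableSpace α] [MeasurableSpace β] {g : α → β}
    (hg : Measurable g) (a b c d : ENNReal) (x y z t : α) :
    (a • Measure.dirac x + b • Measure.dirac y + c • Measure.dirac z + d • Measure.dirac t).map g =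
      a • Measure.dirac (g x) + b • Measure.dirac (g y) + c • Measure.dirac (g z)
        + d • Measure.dirac (g t) := by
  simp only [Measure.map_add _ _ hg, Measure.map_smul, Measure.map_dirac' hg]

/-- The kernel of a plain circuit that is fed with two coins: a sum of four point masses. -/
theorem sem_flip_flip (p q : unitInterval) {c : Circ (v ++ [B, B]) w} (hc : IsPlain c)
    (x : Env (v ++ [])) :
    sem ((idn v ⊠ flip p ⊠ flip q) ⨾ c) x =
      (ENNReal.ofReal p * ENNReal.ofReal q) • Measure.dirac
          (ev c (join v [B, B] ((split v [] x).1, true, true, ())))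
        + (ENNReal.ofReal p * ENNReal.ofReal (1 - q)) • Measure.dirac
          (ev c (join v [B, B] ((split v [] x).1, true, false, ())))
        + (ENNReal.ofReal (1 - p) * ENNReal.ofReal q) • Measure.dirac
          (ev c (join v [B, B] ((split v [] x).1, false, true, ())))
        + (ENNReal.ofReal (1 - p) * ENNReal.ofReal (1 - q)) • Measure.dirac
          (ev c (join v [B, B] ((split v [] x).1, false, false, ()))) := by
  obtain ⟨m, e⟩ := sem_seq_plain_apply (idn v ⊠ flip p ⊠ flip q) hc x
  have h1 (y : Env []) : sem (flip p) y = ENNReal.ofReal p • Measure.dirac (bit true)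
        + ENNReal.ofReal (1 - p) • Measure.dirac (bit false) := rfl
  have h2 (y : Env []) : sem (flip q) y = ENNReal.ofReal q • Measure.dirac (bit true)
        + ENNReal.ofReal (1 - q) • Measure.dirac (bit false) := rfl
  have h3 (y : Env v) : sem (idn v) y = Measure.dirac y := Kernel.id_apply y
  have m1 := measurable_join [B] [B]
  have h4 (y : Env ([] ++ [])) : sem (flip p ⊠ flip q) y =
      (ENNReal.ofReal p * ENNReal.ofReal q) • Measure.dirac (join [B] [B] (bit true, bit true))
      + (ENNReal.ofReal p * ENNReal.ofReal (1 - q)) •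
          Measure.dirac (join [B] [B] (bit true, bit false))
      + (ENNReal.ofReal (1 - p) * ENNReal.ofReal q) •
          Measure.dirac (join [B] [B] (bit false, bit true))
      + (ENNReal.ofReal (1 - p) * ENNReal.ofReal (1 - q)) •
          Measure.dirac (join [B] [B] (bit false, bit false)) := by
    rw [sem_par_apply, h1, h2, ← map_four_dirac m1]
    congr 1
    simp only [Measure.add_prod, Measure.prod_add, Measure.prod_smul_left, Measure.prod_smul_right,
      Measure.dirac_prod_dirac, smul_add, smul_smul]
    simp only [mul_comm]
    abel
  rw [e, sem_par_apply, h3, h4]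
  simp only [Measure.prod_add, Measure.prod_smul_right, Measure.dirac_prod_dirac]
  rw [map_four_dirac (measurable_join v ([B] ++ [B]))]
  exact map_four_dirac m _ _ _ _ _ _ _ _

/-! ### If-then-else on arbitrary bundles -/

/-- If-then-else for truth values, as a Boolean circuit. -/
def choiceB : Circ [B, B, B] [B] :=
  (copy B ⊠ idn [B, B]) ⨾ (idn [B] ⊠ swap [B] [B] ⊠ idn [B]) ⨾
    ((conj ⨾ neg) ⊠ ((neg ⊠ idn [B]) ⨾ conj ⨾ neg)) ⨾ conj ⨾ neg

/-- If-then-else on a single wire of either colour. -/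
def choice : (a : Col) → Circ [B, a, a] [a]
  | B => choiceB
  | R => sel

/-- If-then-else on a bundle of wires, with a shared guard. -/
def chooseW : (w : List Col) → Circ ([B] ++ (w ++ w)) w
  | [] => del B
  | a :: w =>
      (copy B ⊠ mid [a] w [a] w) ⨾ mid [B] [B] [a, a] (w ++ w) ⨾ (choice a ⊠ chooseW w)

theorem chooseW_Rw (n : ℕ) : chooseW (Rw n) = selN n := by
  induction n with
  | zero => rfl
  | succ n ih =>
    have h : chooseW (Rw (n + 1)) =
      (copy B ⊠ mid [R] (Rw n) [R] (Rw n)) ⨾ mid [B] [B] [R, R] (Rw n ++ Rw n) ⨾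
        (sel ⊠ chooseW (Rw n)) := rfl
    rw [h, ih]; rfl

theorem isPlain_choiceB : IsPlain choiceB := by
  simp [choiceB, IsPlain]

theorem isPlain_mid (a b c d : List Col) (h : ∀ x ∈ (a ++ b) ++ (c ++ d), x = B) :
    IsPlain (mid a b c d) := by
  refine ⟨isPlain_wire _ h, ⟨?_, ?_, ?_⟩, isPlain_wire _ ?_⟩ <;>
  · intro x hx
    apply h
    simp only [List.mem_append] at hx ⊢
    tauto

theorem isPlain_chooseW (w : List Col) (h : ∀ a ∈ w, a = B) : IsPlain (chooseW w) := by
  induction w with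
  | nil => exact rfl
  | cons a w ih =>
    have ha : a = B := h a (by simp)
    subst ha
    have hw : ∀ a ∈ w, a = B := fun a ha => h a (by simp [ha])
    refine ⟨⟨rfl, isPlain_mid _ _ _ _ ?_⟩, isPlain_mid _ _ _ _ ?_, isPlain_choiceB, ih hw⟩ <;>
    · intro x hx
      simp only [List.mem_append, List.mem_cons, List.not_mem_nil, or_false] at hx
      rcases hx with hx | hx <;> grind

theorem choose_conj : mk ((idn [B] ⊠ conj ⊠ conj) ⨾ choiceB) = mk (chooseW [B, B] ⨾ conj) := by
  refine mk_eq_of_ev ?_ ?_ ?_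
  · exact ⟨by simp [IsPlain], isPlain_choiceB⟩
  · exact ⟨isPlain_chooseW _ (by simp), trivial⟩
  · rintro ⟨_ | _, _ | _, _ | _, _ | _, _ | _, ⟨⟩⟩ <;> rfl

theorem choose_neg : mk ((idn [B] ⊠ neg ⊠ neg) ⨾ choiceB) = mk (choiceB ⨾ neg) := by
  refine mk_eq_of_ev ?_ ?_ ?_
  · exact ⟨by simp [IsPlain], isPlain_choiceB⟩
  · exact ⟨isPlain_choiceB, trivial⟩
  · rintro ⟨_ | _, _ | _, _ | _, ⟨⟩⟩ <;> rfl

theorem choose_self : mk ((idn [B] ⊠ copy B) ⨾ choiceB) = mk (Circ.del B ⊠ idn [B]) := by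
  refine mk_eq_of_ev ?_ ?_ ?_
  · exact ⟨by simp [IsPlain], isPlain_choiceB⟩
  · simp [IsPlain]
  · rintro ⟨_ | _, _ | _, ⟨⟩⟩ <;> rfl

theorem ofReal_add_one_sub (p : unitInterval) :
    ENNReal.ofReal p + ENNReal.ofReal (1 - p) = 1 := by
  rw [← ENNReal.ofReal_add p.2.1 (sub_nonneg.2 p.2.2)]; simp

/-- Choosing between two independent tosses of the same coin is tossing it once. -/
theorem choose_flip (p : unitInterval) :
    mk ((idn [B] ⊠ flip p ⊠ flip p) ⨾ choiceB) = mk (Circ.del B ⨾ flip p) := by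
  refine mk_eq.2 (.bool (by simp [IsBool, isPlain_choiceB.isBool]) (by simp [IsBool]) ?_)
  ext x : 1
  have h := sem_flip_flip (v := [B]) p p (c := choiceB) isPlain_choiceB x
  have h' : sem (Circ.del B ⨾ flip p) x =
      ENNReal.ofReal p • Measure.dirac (bit true) +
        ENNReal.ofReal (1 - p) • Measure.dirac (bit false) := by
    have key (f : Env [B] → Env []) (hf : Measurable f) (κ : Kernel (Env []) (Env [B])) :
        (κ.comp (detK f hf)) x = κ (f x) := by
      unfold detK
      rw [Kernel.comp_deterministic_eq_comap, Kernel.comap_apply]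
    exact key _ _ _
  rw [h']
  refine h.trans ?_
  have hp := ofReal_add_one_sub p
  generalize ENNReal.ofReal p = P at *
  generalize ENNReal.ofReal (1 - p) = P' at *
  obtain ⟨_ | _, ⟨⟩⟩ := x
  · change (P * P) • Measure.dirac (bit true) + (P * P') • Measure.dirac (bit false) +
      (P' * P) • Measure.dirac (bit true) + (P' * P') • Measure.dirac (bit false) = _
    calc _ = ((P + P') * P) • Measure.dirac (bit true) +
            ((P + P') * P') • Measure.dirac (bit false) := by
          rw [add_mul, add_mul, add_smul, add_smul]; abel
      _ = _ := by rw [hp, one_mul, one_mul]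
  · change (P * P) • Measure.dirac (bit true) + (P * P') • Measure.dirac (bit true) +
      (P' * P) • Measure.dirac (bit false) + (P' * P') • Measure.dirac (bit false) = _
    calc _ = ((P + P') * P) • Measure.dirac (bit true) +
            ((P + P') * P') • Measure.dirac (bit false) := by
          rw [add_mul, add_mul, add_smul, add_smul, mul_comm P' P]; abel
      _ = _ := by rw [hp, one_mul, one_mul]

theorem flip_zero : mk (flip 0) = mk (flip 1 ⨾ neg) := by
  refine mk_eq.2 (.bool (by simp [IsBool]) (by simp [IsBool]) ?_)
  obtain ⟨m, e⟩ := IsPlain.sem_eq (c := flip 1 ⨾ neg) (by simp [IsPlain])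
  rw [e]
  ext x : 1
  refine Eq.trans ?_ (Kernel.deterministic_apply m x).symm
  simp [sem, constK]
  rfl

theorem flip_one_copy : mk (flip 1 ⨾ copy B) = mk (flip 1 ⊠ flip 1) :=
  mk_eq_of_ev (by simp [IsPlain]) (by simp [IsPlain]) (fun _ => rfl)

theorem det_mk_conj : Det (mk conj) := by
  rw [Det, cp_singleton]; exact mk_eq.2 (.axm (.bool_copy _ .conj))

theorem det_mk_neg : Det (mk neg) := by
  rw [Det, cp_singleton]; exact mk_eq.2 (.axm (.bool_copy _ .neg))

theorem det_flip_one : Det (mk (flip 1)) := by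
  rw [Det, cp_singleton]
  exact flip_one_copy.trans (one_seq _).symm

theorem det_flip_zero : Det (mk (flip 0)) := by
  rw [flip_zero]; exact det_flip_one.seq det_mk_neg

theorem det_choiceB : Det (mk choiceB) := by
  have h1 : Det (mk (Circ.copy B)) := cp_singleton B ▸ det_cp [B]
  have h2 : Det (mk (idn [B] ⊠ swap [B] [B] ⊠ idn [B])) :=
    (det_one [B]).par ((det_sw [B] [B]).par (det_one [B]))
  have h3 : Det (mk ((conj ⨾ neg) ⊠ ((neg ⊠ idn [B]) ⨾ conj ⨾ neg))) :=
    (det_mk_conj.seq det_mk_neg).par ((det_mk_neg.par (det_one [B])).seq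
      (det_mk_conj.seq det_mk_neg))
  exact (h1.par (det_one [B, B])).seq (h2.seq (h3.seq (det_mk_conj.seq det_mk_neg)))

/-- The class of `chooseW`. -/
def cw (w : List Col) : Mor ([B] ++ (w ++ w)) w := mk (chooseW w)

/-- If-then-else on a bundle of wires. -/
def ite (b : Mor u [B]) (x y : Mor u w) : Mor u w := pair b (pair x y) ⟫ cw w

/-- If-then-else on a single wire of either colour. -/
def cs (a : Col) : Mor ([B] ++ ([a] ++ [a])) [a] := mk (choice a)

theorem ite_cons {a : Col} {b : Mor u [B]} (hb : Det b) (x y : Mor u [a]) (x' y' : Mor u w) :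
    ite b (pair x x') (pair y y') =
      (pair (pair b (pair x y) ⟫ cs a) (ite b x' y') : Mor u ([a] ++ w)) := by
  have e : cw ([a] ++ w) = (cp [B] ⫴ md [a] w [a] w) ⟫ md [B] [B] ([a] ++ [a]) (w ++ w) ⟫
      (cs a ⫴ cw w) := by rw [cp_singleton]; rfl
  rw [ite, e, ← seq_assoc, pair_seq_par, hb, pair_md, ← seq_assoc, pair_md, pair_seq_par]; rfl

theorem cw_singleton (a : Col) : cw [a] = cs a := by
  have pd {v : List Col} (f : Mor v [a]) : (pair f (dl v) : Mor v ([a] ++ [])) = f :=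
    (pair_dl f).trans (seq_one _)
  have h := ite_cons (w := []) (det_fst [B] ([a] ++ [a])) (snd [B] ([a] ++ [a]) ⟫ fst [a] [a])
    (snd [B] ([a] ++ [a]) ⟫ snd [a] [a]) (dl _) (dl _)
  have e1 : (snd [B] ([a] ++ [a]) ⟫ fst [a] [a]) =
      pair (snd [B] ([a] ++ [a]) ⟫ fst [a] [a]) (dl _) := (pd _).symm
  have e2 : (snd [B] ([a] ++ [a]) ⟫ snd [a] [a]) =
      pair (snd [B] ([a] ++ [a]) ⟫ snd [a] [a]) (dl _) := (pd _).symm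
  have e3 : pair (fst [B] ([a] ++ [a])) (pair (snd [B] ([a] ++ [a]) ⟫ fst [a] [a])
    (snd [B] ([a] ++ [a]) ⟫ snd [a] [a])) = one _ := by
    rw [pair_eta _ (det_snd _ _), pair_fst_snd]
  calc cw [a] = ite (fst [B] ([a] ++ [a])) (snd [B] ([a] ++ [a]) ⟫ fst [a] [a])
          (snd [B] ([a] ++ [a]) ⟫ snd [a] [a]) := by
        rw [ite, e3, one_seq]
    _ = ite (w := [a] ++ []) (fst [B] ([a] ++ [a]))
          (pair (snd [B] ([a] ++ [a]) ⟫ fst [a] [a]) (dl _))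
          (pair (snd [B] ([a] ++ [a]) ⟫ snd [a] [a]) (dl _)) := congrArg₂ (ite _) e1 e2
    _ = pair (cs a) (dl _) := by
        rw [h, e3, one_seq, eq_dl (ite _ _ _)]
    _ = cs a := pd _

theorem ite_eq_iteR (b : Mor u [B]) (x y : Mor u [R]) : ite b x y = iteR b x y := by
  rw [ite, cw_singleton]; rfl

/-- If-then-else acts separately on the parts of a bundle. The case of arbitrary first parts, in
`ite_pair`, follows by applying this to projections. -/
theorem ite_pair_of_det {b : Mor u [B]} (hb : Det b) {x y : Mor u v} (hx : Det x) (hy : Det y)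
    (x' y' : Mor u w) :
    ite b (pair x x') (pair y y') = pair (ite b x y) (ite b x' y') := by
  induction v with
  | nil =>
    refine Eq.trans ?_ (nil_pair (ite b x y) (ite b x' y')).symm
    exact congrArg₂ (ite b) (nil_pair x x') (nil_pair y y')
  | cons a v ih =>
    have ex := pair_eta (v := [a]) (w := v) x hx
    have ey := pair_eta (v := [a]) (w := v) y hy
    have hx2 := hx.seq (det_snd [a] v)
    have hy2 := hy.seq (det_snd [a] v)
    generalize (x ⟫ fst [a] v) = x1 at ex
    generalize (y ⟫ fst [a] v) = y1 at ey
    generalize (x ⟫ snd [a] v) = x2 at ex hx2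
    generalize (y ⟫ snd [a] v) = y2 at ey hy2
    subst ex ey
    calc ite b (pair (pair x1 x2) x') (pair (pair y1 y2) y')
      _ = (ite b (pair x1 (pair x2 x')) (pair y1 (pair y2 y')) : Mor u ([a] ++ (v ++ w))) :=
          congrArg₂ (ite b) (pair_assoc_single x1 x2 x').symm (pair_assoc_single y1 y2 y').symm
      _ = pair (pair b (pair x1 y1) ⟫ cs a) (pair (ite b x2 y2) (ite b x' y')) := by
          rw [ite_cons hb, ih hx2 hy2]
      _ = pair (pair (pair b (pair x1 y1) ⟫ cs a) (ite b x2 y2)) (ite b x' y') :=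
          pair_assoc_single _ _ _
      _ = _ := congrArg (pair · _) (ite_cons hb x1 y1 x2 y2).symm

theorem cw_append (v w : List Col) : cw (v ++ w) =
    (cp [B] ⫴ md v w v w) ⟫ md [B] [B] (v ++ v) (w ++ w) ⟫ (cw v ⫴ cw w) := by
  have hb := det_fst [B] ((v ++ w) ++ (v ++ w))
  have h1 := (det_snd [B] ((v ++ w) ++ (v ++ w))).seq (det_fst _ _)
  have h2 := (det_snd [B] ((v ++ w) ++ (v ++ w))).seq (det_snd _ _)
  have e : pair (fst [B] ((v ++ w) ++ (v ++ w))) (pair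
      (snd [B] ((v ++ w) ++ (v ++ w)) ⟫ fst (v ++ w) (v ++ w))
      (snd [B] ((v ++ w) ++ (v ++ w)) ⟫ snd (v ++ w) (v ++ w))) = one _ := by
    rw [pair_eta _ (det_snd _ _), pair_fst_snd]
  have ex := pair_eta _ h1
  have ey := pair_eta _ h2
  have h := ite_pair_of_det hb (h1.seq (det_fst v w)) (h2.seq (det_fst v w))
    ((snd [B] ((v ++ w) ++ (v ++ w)) ⟫ fst (v ++ w) (v ++ w)) ⟫ snd v w)
    ((snd [B] ((v ++ w) ++ (v ++ w)) ⟫ snd (v ++ w) (v ++ w)) ⟫ snd v w)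
  rw [ex, ey, ite, e, one_seq] at h
  rw [h, ← one_seq ((cp [B] ⫴ md v w v w) ⟫ _), ← e, ← ex, ← ey, ← seq_assoc, pair_seq_par, hb,
    pair_md, ← seq_assoc, pair_md, pair_seq_par, ex, ey]
  rfl

theorem ite_pair {b : Mor u [B]} (hb : Det b) (x y : Mor u v) (x' y' : Mor u w) :
    ite b (pair x x') (pair y y') = pair (ite b x y) (ite b x' y') := by
  rw [ite, cw_append, ← seq_assoc, pair_seq_par, hb, pair_md, ← seq_assoc, pair_md, pair_seq_par]
  rfl

/-! ### Naturality of if-then-else -/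

theorem ite_seq_of_natural {f : Mor v w} (h : (one [B] ⫴ (f ⫴ f)) ⟫ cw w = cw v ⟫ f)
    (b : Mor u [B]) (x y : Mor u v) : ite b (x ⟫ f) (y ⟫ f) = ite b x y ⟫ f := by
  rw [ite, ite, seq_assoc, ← h, ← seq_assoc, pair_seq_par, pair_seq_par, seq_one]

theorem pair_vars (v w x : List Col) :
    pair (fst v (w ++ x)) (pair (snd v (w ++ x) ⟫ fst w x) (snd v (w ++ x) ⟫ snd w x)) =
      one (v ++ (w ++ x)) := by
  rw [pair_eta _ (det_snd _ _), pair_fst_snd]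

/-- Naturality may be checked on deterministic arguments. -/
theorem natural_of_det {f : Mor v w} (h : ∀ {u : List Col} (b : Mor u [B]) (x y : Mor u v),
    Det b → Det x → Det y → ite b (x ⟫ f) (y ⟫ f) = ite b x y ⟫ f) :
    (one [B] ⫴ (f ⫴ f)) ⟫ cw w = cw v ⟫ f := by
  have e := h (fst [B] (v ++ v)) (snd [B] (v ++ v) ⟫ fst v v) (snd [B] (v ++ v) ⟫ snd v v)
    (det_fst _ _) ((det_snd _ _).seq (det_fst _ _)) ((det_snd _ _).seq (det_snd _ _))
  rw [ite, ite, ← pair_seq_par, pair_vars, one_seq] at e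
  rw [← e, ← one_seq (one [B] ⫴ (f ⫴ f)), ← pair_vars, pair_seq_par, pair_seq_par, seq_one]

theorem real_natural {m n : ℕ} (c : Circ (Rw m) (Rw n)) :
    (one [B] ⫴ (mk c ⫴ mk c)) ⟫ cw (Rw n) = cw (Rw m) ⟫ mk c := by
  rw [cw, cw, chooseW_Rw, chooseW_Rw]
  exact (mk_eq.2 (.axm (.ite_natural c))).symm

/-- The if-then-else gate can be copied, because it commutes with copying a real wire. -/
theorem det_selC : Det selC := by
  have h : (one [B] ⫴ (mk (Circ.copy R) ⫴ mk (Circ.copy R))) ⟫ cw [R, R] =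
      cw [R] ⟫ mk (Circ.copy R) := real_natural (m := 1) (n := 2) (Circ.copy R)
  rw [← cp_singleton, cw_singleton] at h
  refine Eq.trans h.symm ?_
  have e : one [B] ⫴ (cp [R] ⫴ cp [R]) = pair (fst [B] ([R] ++ [R]))
      (pair (pair (snd [B] ([R] ++ [R]) ⟫ fst [R] [R]) (snd [B] ([R] ++ [R]) ⟫ fst [R] [R]))
        (pair (snd [B] ([R] ++ [R]) ⟫ snd [R] [R]) (snd [B] ([R] ++ [R]) ⟫ snd [R] [R]))) := by
    have h1 : Det (snd [B] ([R] ++ [R]) ⟫ fst [R] [R]) := (det_snd _ _).seq (det_fst _ _)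
    have h2 : Det (snd [B] ([R] ++ [R]) ⟫ snd [R] [R]) := (det_snd _ _).seq (det_snd _ _)
    rw [← h1, ← h2, ← pair_seq_par, ← seq_one (fst [B] ([R] ++ [R])), ← pair_seq_par, pair_vars,
      one_seq]
  have e2 := ite_pair (det_fst [B] ([R] ++ [R])) (snd [B] ([R] ++ [R]) ⟫ fst [R] [R])
    (snd [B] ([R] ++ [R]) ⟫ snd [R] [R]) (snd [B] ([R] ++ [R]) ⟫ fst [R] [R])
    (snd [B] ([R] ++ [R]) ⟫ snd [R] [R])
  rw [ite_eq_iteR, iteR, pair_vars, one_seq] at e2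
  rw [← e2, ite, ← e]
  rfl

theorem det_cs (a : Col) : Det (cs a) := by
  cases a
  · exact det_choiceB
  · exact det_selC

theorem ite_eq_choice {b : Mor u [B]} (hb : Det b) (a a' : Mor u [B]) :
    ite b a a' = notB (andB (notB (andB b a)) (notB (andB (notB b) a'))) := by
  have h1 : pair b (pair a a') ⟫ (cp [B] ⫴ one ([B] ++ [B])) =
      (pair b (pair (pair b a) a') : Mor u ([B] ++ (([B] ++ [B]) ++ [B]))) := by
    rw [pair_seq_par, hb, seq_one]
    refine (pair_assoc_single b b _).symm.trans ?_
    exact congrArg (pair b) (pair_assoc_single b a a')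
  have h2 : pair b (pair (pair b a) a') ⟫ (one [B] ⫴ (sw [B] [B] ⫴ one [B])) =
      (pair (pair b a) (pair b a') : Mor u (([B] ++ [B]) ++ ([B] ++ [B]))) := by
    rw [pair_seq_par, pair_seq_par, pair_sw, seq_one, seq_one]
    refine Eq.trans ?_ (pair_assoc_single b a _)
    exact congrArg (pair b) (pair_assoc_single a b a').symm
  have h3 : pair (pair b a) (pair b a') ⟫ (((mk conj : Mor ([B] ++ [B]) [B]) ⟫ mk neg) ⫴
      ((mk neg ⫴ one [B]) ⟫ (mk conj : Mor ([B] ++ [B]) [B]) ⟫ mk neg)) =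
      pair (notB (andB b a)) (notB (andB (notB b) a')) := by
    rw [pair_seq_par, ← seq_assoc, ← seq_assoc, ← seq_assoc, pair_seq_par, seq_one]; rfl
  rw [ite, cw_singleton]
  calc pair b (pair a a') ⟫ cs B
    _ = pair b (pair a a') ⟫ (cp [B] ⫴ one ([B] ++ [B])) ⟫ (one [B] ⫴ (sw [B] [B] ⫴ one [B])) ⟫
        (((mk conj : Mor ([B] ++ [B]) [B]) ⟫ mk neg) ⫴
        ((mk neg ⫴ one [B]) ⟫ (mk conj : Mor ([B] ++ [B]) [B]) ⟫ mk neg)) ⟫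
        (mk conj : Mor ([B] ++ [B]) [B]) ⟫ mk neg := by rw [cp_singleton]; rfl
    _ = pair b (pair (pair b a) a') ⟫ (one [B] ⫴ (sw [B] [B] ⫴ one [B])) ⟫
        (((mk conj : Mor ([B] ++ [B]) [B]) ⟫ mk neg) ⫴
        ((mk neg ⫴ one [B]) ⟫ (mk conj : Mor ([B] ++ [B]) [B]) ⟫ mk neg)) ⟫
        (mk conj : Mor ([B] ++ [B]) [B]) ⟫ mk neg := by
          rw [← h1]; exact (seq_assoc _ _ _).symm
    _ = pair (pair b a) (pair b a') ⟫
        (((mk conj : Mor ([B] ++ [B]) [B]) ⟫ mk neg) ⫴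
        ((mk neg ⫴ one [B]) ⟫ (mk conj : Mor ([B] ++ [B]) [B]) ⟫ mk neg)) ⟫
        (mk conj : Mor ([B] ++ [B]) [B]) ⟫ mk neg := by
          rw [← h2]; exact (seq_assoc _ _ _).symm
    _ = _ := by rw [← seq_assoc, h3, ← seq_assoc]; rfl

/-- Naturality of if-then-else for the if-then-else gate. -/
theorem sel_natural : (one [B] ⫴ (selC ⫴ selC)) ⟫ cw [R] = cw ([B] ++ ([R] ++ [R])) ⟫ selC := by
  refine natural_of_det fun {u} b x y hb hx hy => ?_
  have ex := pair_eta x hx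
  have ex' := pair_eta _ (hx.seq (det_snd [B] ([R] ++ [R])))
  have ey := pair_eta y hy
  have ey' := pair_eta _ (hy.seq (det_snd [B] ([R] ++ [R])))
  have ha := hx.seq (det_fst [B] ([R] ++ [R]))
  have ha' := hy.seq (det_fst [B] ([R] ++ [R]))
  have h1 := (hx.seq (det_snd [B] ([R] ++ [R]))).seq (det_fst _ _)
  have h2 := (hx.seq (det_snd [B] ([R] ++ [R]))).seq (det_snd _ _)
  have h3 := (hy.seq (det_snd [B] ([R] ++ [R]))).seq (det_fst _ _)
  have h4 := (hy.seq (det_snd [B] ([R] ++ [R]))).seq (det_snd _ _)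
  rw [← ex'] at ex
  rw [← ey'] at ey
  generalize x ⟫ fst [B] ([R] ++ [R]) = a at *
  generalize y ⟫ fst [B] ([R] ++ [R]) = a' at *
  generalize (x ⟫ snd [B] ([R] ++ [R])) ⟫ fst _ _ = x1 at *
  generalize (x ⟫ snd [B] ([R] ++ [R])) ⟫ snd _ _ = x2 at *
  generalize (y ⟫ snd [B] ([R] ++ [R])) ⟫ fst _ _ = y1 at *
  generalize (y ⟫ snd [B] ([R] ++ [R])) ⟫ snd _ _ = y2 at *
  subst ex ey
  have hz {c : Mor u [B]} {p q : Mor u [R]} (hc : Det c) (hp : Det p) (hq : Det q) :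
      Det (iteR c p q) := (hc.pair (hp.pair hq)).seq det_selC
  rw [ite_pair hb, ite_pair hb]
  change ite b (iteR a x1 x2) (iteR a' y1 y2) = iteR (ite b a a') (ite b x1 y1) (ite b x2 y2)
  rw [ite_eq_iteR, ite_eq_iteR, ite_eq_iteR, ite_eq_choice hb,
    iteR_choice hb ha ha' (hz hb h1 h3) (hz hb h2 h4) det_selC, iteR_iteR ha hb, iteR_iteR ha' hb,
    iteR_same_left hb, iteR_same_right hb]

/-- If-then-else commutes with every circuit, even with one that samples: only one of the two
branches is used. -/
theorem cw_natural (f : Mor v w) : (one [B] ⫴ (f ⫴ f)) ⟫ cw w = cw v ⟫ f := by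
  obtain ⟨c, rfl⟩ := mk_surjective f
  induction c with
  | idn v => rw [mk_idn, one_par_one, one_par_one, one_seq, seq_one]
  | swap v w =>
      refine natural_of_det fun b x y hb hx hy => ?_
      rw [← pair_eta x hx, ← pair_eta y hy, mk_swap, pair_sw, pair_sw, ite_pair hb, ite_pair hb,
        pair_sw]
  | seq c d hc hd =>
      refine natural_of_det fun b x y _ _ _ => ?_
      rw [mk_seq, ← seq_assoc, ← seq_assoc, ite_seq_of_natural hd, ite_seq_of_natural hc, seq_assoc]
  | par c d hc hd =>
      refine natural_of_det fun b x y hb hx hy => ?_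
      rw [← pair_eta x hx, ← pair_eta y hy, mk_par, pair_seq_par, pair_seq_par, ite_pair hb,
        ite_pair hb, ite_seq_of_natural hc, ite_seq_of_natural hd, pair_seq_par]
  | del a => exact (eq_dl _).trans (eq_dl _).symm
  | copy a =>
      refine natural_of_det fun b x y hb hx hy => ?_
      have h : Det (ite b x y) := by
        rw [ite, cw_singleton]
        exact (hb.pair (hx.pair hy)).seq (det_cs a)
      have e := ite_pair hb x y x y
      rw [← cp_singleton]
      refine Eq.trans ?_ h.symm
      rw [← e, ← hx, ← hy]
  | conj => rw [cw_singleton]; exact choose_conj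
  | neg => rw [cw_singleton]; exact choose_neg
  | flip p => rw [cw_singleton]; exact choose_flip p
  | zero => exact real_natural (m := 0) (n := 1) Circ.zero
  | add => exact real_natural (m := 2) (n := 1) Circ.add
  | scal k => exact real_natural (m := 1) (n := 1) (Circ.scal k)
  | one => exact real_natural (m := 0) (n := 1) Circ.one
  | normal => exact real_natural (m := 0) (n := 1) Circ.normal
  | sel => exact sel_natural

theorem ite_seq (b : Mor u [B]) (x y : Mor u v) (f : Mor v w) :
    ite b (x ⟫ f) (y ⟫ f) = ite b x y ⟫ f := ite_seq_of_natural (cw_natural f) b x y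

/-! ### Case distinction on a Boolean input -/

theorem ite_dl_seq (f : Mor [] [B]) (x y : Mor u w) :
    ite (dl u ⟫ f) x y = pair x y ⟫ (((f ⫴ one (w ++ w)) ⟫ cw w) : Mor (w ++ w) w) := by
  have h : pair (dl u ⟫ f) (pair x y) = pair (dl u) (pair x y) ⟫ (f ⫴ one (w ++ w)) := by
    rw [pair_seq_par, seq_one]
  rw [ite, h, seq_assoc]
  exact congrArg (· ⟫ ((f ⫴ one (w ++ w)) ⟫ cw w)) (nil_pair (dl u) (pair x y))

theorem choose_flip_one : mk ((flip 1 ⊠ idn [B, B]) ⨾ choiceB) = mk (idn [B] ⊠ Circ.del B :) := by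
  refine mk_eq_of_ev ?_ ?_ ?_
  · exact ⟨by simp [IsPlain], isPlain_choiceB⟩
  · simp [IsPlain]
  · rintro ⟨_ | _, _ | _, ⟨⟩⟩ <;> rfl

theorem choose_flip_zero :
    mk (((flip 1 ⨾ neg) ⊠ idn [B, B]) ⨾ choiceB) = mk (Circ.del B ⊠ idn [B] :) := by
  refine mk_eq_of_ev ?_ ?_ ?_
  · exact ⟨by simp [IsPlain], isPlain_choiceB⟩
  · simp [IsPlain]
  · rintro ⟨_ | _, _ | _, ⟨⟩⟩ <;> rfl

theorem ite_flip_one_single {a : Col} (x y : Mor u [a]) : ite (dl u ⟫ mk (flip 1)) x y = x := by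
  cases a with
  | R => rw [ite_eq_iteR, iteR_flip_one]
  | B =>
    have h : ((mk (flip 1) ⫴ one ([B] ++ [B])) ⟫ cs B : Mor ([B] ++ [B]) [B]) = fst [B] [B] := by
      refine choose_flip_one.trans ?_
      rw [fst, dl_singleton]
      exact (seq_one _).symm
    rw [ite_dl_seq, cw_singleton, h, pair_fst]

theorem ite_flip_zero_single {a : Col} (x y : Mor u [a]) : ite (dl u ⟫ mk (flip 0)) x y = y := by
  cases a with
  | R => rw [ite_eq_iteR, iteR_flip_zero]
  | B =>
    have h : ((mk (flip 0) ⫴ one ([B] ++ [B])) ⟫ cs B : Mor ([B] ++ [B]) [B]) = snd [B] [B] := by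
      rw [flip_zero]
      refine choose_flip_zero.trans ?_
      rw [snd, dl_singleton]; rfl
    rw [ite_dl_seq, cw_singleton, h, pair_snd]

theorem choose_flip_one_flip_zero :
    mk ((idn [B] ⊠ flip 1 ⊠ (flip 1 ⨾ neg)) ⨾ choiceB) = mk (idn [B]) := by
  refine mk_eq_of_ev ?_ ?_ ?_
  · exact ⟨by simp [IsPlain], isPlain_choiceB⟩
  · simp [IsPlain]
  · rintro ⟨_ | _, ⟨⟩⟩ <;> rfl

theorem ite_self_single {a : Col} (b : Mor u [B]) {x : Mor u [a]} (hx : Det x) :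
    ite b x x = x := by
  cases a with
  | R => rw [ite_eq_iteR, iteR_self b hx]
  | B =>
    have h : (one [B] ⫴ cp [B]) ⟫ cs B = dl [B] ⫴ one [B] := by
      rw [cp_singleton, dl_singleton]; exact choose_self
    rw [ite, cw_singleton, ← hx, ← seq_one b, ← pair_seq_par, seq_assoc, h]
    exact pair_snd b x

theorem Det.ite {b : Mor u [B]} {x y : Mor u w} (hb : Det b) (hx : Det x) (hy : Det y) :
    Det (ite b x y) := by
  rw [Det, ← ite_seq, hx, hy, ite_pair hb]

/-- Deterministic circuits are determined by their single output wires. -/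
theorem Det.ext {f g : Mor u w} (hf : Det f) (hg : Det g)
    (h : ∀ (a : Col) (p : Mor w [a]), Det p → f ⟫ p = g ⟫ p) : f = g := by
  induction w with
  | nil => exact (eq_dl _).trans (eq_dl _).symm
  | cons a w ih =>
    have ef := pair_eta (v := [a]) (w := w) f hf
    have eg := pair_eta (v := [a]) (w := w) g hg
    have h1 := h a (fst [a] w) (det_fst _ _)
    have h2 := ih (hf.seq (det_snd [a] w)) (hg.seq (det_snd [a] w)) (fun a' p hp =>
      (seq_assoc _ _ _).trans ((h a' (snd [a] w ⟫ p) ((det_snd _ _).seq hp)).trans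
        (seq_assoc _ _ _).symm))
    rw [h1] at ef
    exact ef.symm.trans ((congrArg (MixCirc.pair (g ⟫ fst [a] w)) h2).trans eg)

theorem ite_flip_one (x y : Mor u w) : ite (dl u ⟫ mk (flip 1)) x y = x := by
  have h : ite (dl (w ++ w) ⟫ mk (flip 1)) (fst w w) (snd w w) = fst w w :=
    (((det_dl (w ++ w)).seq det_flip_one).ite (det_fst w w) (det_snd w w)).ext (det_fst w w)
      fun a p _ => by rw [← ite_seq, ite_flip_one_single]
  rw [ite_dl_seq, pair_fst_snd, one_seq] at h
  rw [ite_dl_seq, h, pair_fst]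

theorem ite_flip_zero (x y : Mor u w) : ite (dl u ⟫ mk (flip 0)) x y = y := by
  have h : ite (dl (w ++ w) ⟫ mk (flip 0)) (fst w w) (snd w w) = snd w w :=
    (((det_dl (w ++ w)).seq det_flip_zero).ite (det_fst w w) (det_snd w w)).ext (det_snd w w)
      fun a p _ => by rw [← ite_seq, ite_flip_zero_single]
  rw [ite_dl_seq, pair_fst_snd, one_seq] at h
  rw [ite_dl_seq, h, pair_snd]

theorem ite_self {b : Mor u [B]} (hb : Det b) (x : Mor u w) : ite b x x = x := by
  have h : ite b (one u) (one u) = one u := (hb.ite (det_one u) (det_one u)).ext (det_one u)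
    fun a p hp => by rw [← ite_seq, one_seq, ite_self_single b hp]
  have e := ite_seq b (one u) (one u) x
  rwa [h, one_seq] at e

/-- The circuit that behaves as `f` if its first input is true, and as `g` otherwise. -/
def condM (f g : Mor v w) : Mor ([B] ++ v) w := ite (fst [B] v) (snd [B] v ⟫ f) (snd [B] v ⟫ g)

/-- Feeding a coin to the first input; for the probabilities `1` and `0` this is the substitution
of a truth value. -/
def inst (p : unitInterval) (f : Mor ([B] ++ v) w) : Mor v w := (mk (flip p) ⫴ one v) ⟫ f

/-- Convex combinations of circuits. -/
def mixM (p : unitInterval) (f g : Mor v w) : Mor v w := inst p (condM f g)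

theorem condM_eq (f g : Mor v w) :
    condM f g = (one [B] ⫴ cp v) ⟫ (one [B] ⫴ (f ⫴ g)) ⟫ cw w := by
  rw [condM, ite, ← (det_snd [B] v).seq_pair, ← seq_assoc, par_seq_par, seq_one, par_eq_pair,
    seq_one]
  rfl

theorem mk_cond {n : ℕ} (c d : Circ v (Rw n)) : mk (cond c d) = condM (mk c) (mk d) := by
  rw [condM_eq, cw, chooseW_Rw]; rfl

theorem mk_mix {n : ℕ} (p : unitInterval) (c d : Circ v (Rw n)) :
    mk (mix p c d) = mixM p (mk c) (mk d) := by
  rw [mixM, ← mk_cond]; rfl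

theorem par_eq_pair_of_nil (f : Mor [] v) (g : Mor u w) : f ⫴ g = pair (dl u ⟫ f) g := by
  have h := pair_seq_par (dl u) (one u) f g
  rw [one_seq] at h
  rw [← h]
  refine ((one_seq _).symm.trans (congrArg (· ⟫ (f ⫴ g)) ?_))
  exact (nil_pair (dl u) (one u)).symm

theorem inst_condM (p : unitInterval) (f g : Mor v w) :
    inst p (condM f g) = ite (dl v ⟫ mk (flip p)) f g := by
  rw [inst, condM_eq, ← seq_assoc, ← seq_assoc, par_seq_par, seq_one, one_seq, par_seq_par, seq_one]
  exact congrArg (· ⟫ cw w) (par_eq_pair_of_nil (mk (flip p)) (pair f g))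

theorem inst_one_condM (f g : Mor v w) : inst 1 (condM f g) = f := by
  rw [inst_condM, ite_flip_one]

theorem inst_zero_condM (f g : Mor v w) : inst 0 (condM f g) = g := by
  rw [inst_condM, ite_flip_zero]

theorem ite_flip_one_flip_zero (b : Mor u [B]) :
    ite b (dl u ⟫ mk (flip 1)) (dl u ⟫ mk (flip 0)) = b := by
  have h : (one [B] ⫴ mk (flip 1) ⫴ mk (flip 0)) ⟫ cs B = one [B] := by
    rw [flip_zero]; exact choose_flip_one_flip_zero
  have hn : (pair (dl u) (dl u) : Mor u ([] ++ [])) = dl u := eq_dl _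
  have e : pair b (pair (dl u ⟫ mk (flip 1)) (dl u ⟫ mk (flip 0))) =
      b ⟫ (one [B] ⫴ mk (flip 1) ⫴ mk (flip 0)) := by
    rw [← pair_seq_par, ← seq_one b, ← pair_seq_par, seq_one]
    exact congrArg (· ⟫ (one [B] ⫴ mk (flip 1) ⫴ mk (flip 0)))
      ((congrArg (pair b) hn).trans ((pair_dl b).trans (seq_one _)))
  rw [ite, cw_singleton, e, seq_assoc, h, seq_one]

/-- Shannon expansion: every circuit is a case distinction on its first Boolean input. -/
theorem condM_inst (f : Mor ([B] ++ v) w) : condM (inst 1 f) (inst 0 f) = f := by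
  have h (p : unitInterval) : snd [B] v ⟫ inst p f =
      pair (dl ([B] ++ v) ⟫ mk (flip p)) (snd [B] v) ⟫ f := by
    have e : inst p f = pair (dl v ⟫ mk (flip p)) (one v) ⟫ f :=
      congrArg (· ⟫ f) (par_eq_pair_of_nil (mk (flip p)) (one v))
    rw [e, ← seq_assoc, (det_snd [B] v).seq_pair, ← seq_assoc, seq_dl, seq_one]
  rw [condM, h, h, ite_seq, ite_pair (det_fst [B] v), ite_flip_one_flip_zero,
    ite_self (det_fst [B] v), pair_fst_snd, one_seq]

/-- Circuits are equal if they are equal for both values of their first Boolean input. -/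
theorem ext_inst {f g : Mor ([B] ++ v) w} (h1 : inst 1 f = inst 1 g) (h0 : inst 0 f = inst 0 g) :
    f = g := by
  rw [← condM_inst f, h1, h0, condM_inst]

theorem mixM_inst (p : unitInterval) (f : Mor ([B] ++ v) w) :
    mixM p (inst 1 f) (inst 0 f) = inst p f := by
  rw [mixM, condM_inst]

theorem inst_seq (p : unitInterval) (f : Mor ([B] ++ v) w) (g : Mor w x) :
    inst p (f ⟫ g) = inst p f ⟫ g := (seq_assoc _ _ _).symm

theorem inst_par_seq (p : unitInterval) (g : Mor u v) (f : Mor ([B] ++ v) w) :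
    inst p ((one [B] ⫴ g) ⟫ f) = g ⟫ inst p f := by
  have h : (mk (flip p) ⫴ one u) ⟫ (one [B] ⫴ g) = g ⟫ (mk (flip p) ⫴ one v) := by
    rw [par_seq_par, one_seq, seq_one]
    have e := par_seq_par (one []) (mk (flip p)) g (one v)
    rw [seq_one, one_seq, nil_par] at e
    exact e.symm
  rw [inst, inst, ← seq_assoc, h, seq_assoc]

theorem inst_snd (p : unitInterval) (f : Mor v w) : inst p (snd [B] v ⟫ f) = f := by
  have h : inst p (snd [B] v) = one v := by
    rw [inst, snd, par_seq_par, seq_dl, seq_one]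
    exact nil_par (one v)
  rw [inst_seq, h, one_seq]

theorem condM_seq (f g : Mor v w) (h : Mor w x) : condM f g ⟫ h = condM (f ⟫ h) (g ⟫ h) :=
  ext_inst (by rw [inst_seq, inst_one_condM, inst_one_condM])
    (by rw [inst_seq, inst_zero_condM, inst_zero_condM])

theorem seq_condM (h : Mor u v) (f g : Mor v w) :
    (one [B] ⫴ h) ⟫ condM f g = condM (h ⟫ f) (h ⟫ g) :=
  ext_inst (by rw [inst_par_seq, inst_one_condM, inst_one_condM])
    (by rw [inst_par_seq, inst_zero_condM, inst_zero_condM])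

theorem mixM_seq (p : unitInterval) (f g : Mor v w) (h : Mor w x) :
    mixM p f g ⟫ h = mixM p (f ⟫ h) (g ⟫ h) := by
  rw [mixM, ← inst_seq, condM_seq]; rfl

theorem seq_mixM (p : unitInterval) (h : Mor u v) (f g : Mor v w) :
    h ⟫ mixM p f g = mixM p (h ⟫ f) (h ⟫ g) := by
  rw [mixM, ← inst_par_seq, seq_condM]; rfl

theorem inst_par (p : unitInterval) (f : Mor ([B] ++ v) w) (g : Mor v' w') :
    inst p f ⫴ g = inst (v := v ++ v') p (f ⫴ g :) := by
  have h : (mk (flip p) ⫴ one v) ⫴ one v' = (mk (flip p) ⫴ one (v ++ v') :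
      Mor ([] ++ (v ++ v')) ([B] ++ (v ++ v'))) := by
    refine (seq_one _).symm.trans ((par_assoc (mk (flip p)) (one v) (one v')).trans ?_)
    refine (one_seq _).trans ?_
    rw [one_par_one]
  have e : inst p f ⫴ g = ((mk (flip p) ⫴ one v) ⫴ one v') ⟫ (f ⫴ g) := by
    rw [par_seq_par, one_seq]; rfl
  rw [e, h]; rfl

theorem condM_par (f g : Mor v w) (h : Mor v' w') :
    @Eq (Mor ([B] ++ (v ++ v')) (w ++ w')) (condM f g ⫴ h :) (condM (f ⫴ h) (g ⫴ h)) :=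
  ext_inst (by rw [← inst_par, inst_one_condM, inst_one_condM])
    (by rw [← inst_par, inst_zero_condM, inst_zero_condM])

theorem mixM_par (p : unitInterval) (f g : Mor v w) (h : Mor v' w') :
    mixM p f g ⫴ h = mixM p (f ⫴ h) (g ⫴ h) := by
  rw [mixM, inst_par, condM_par]; rfl

theorem par_eq_sw (f : Mor v w) (g : Mor v' w') : f ⫴ g = sw v v' ⟫ (g ⫴ f) ⟫ sw w' w := by
  rw [par_sw, ← seq_assoc, sw_sw, one_seq]

theorem par_mixM (p : unitInterval) (f g : Mor v w) (h : Mor v' w') :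
    h ⫴ mixM p f g = mixM p (h ⫴ f) (h ⫴ g) := by
  rw [par_eq_sw, mixM_par, mixM_seq, seq_mixM, ← par_eq_sw, ← par_eq_sw]

/-! ### Skew associativity of convex combinations -/

theorem inst_mixM (p q : unitInterval) (f g : Mor ([B] ++ v) w) :
    inst q (mixM p f g) = mixM p (inst q f) (inst q g) := seq_mixM p (mk (flip q) ⫴ one v) f g

/-- Feeding a source of two truth values to the first two inputs. -/
def inst₂ (s : Mor [] ([B] ++ [B])) (f : Mor (([B] ++ [B]) ++ v) w) : Mor v w := (s ⫴ one v) ⟫ f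

theorem inst_inst (p q : unitInterval) (f : Mor ([B] ++ ([B] ++ v)) w) :
    inst q (inst p f) = inst₂ (mk (flip p) ⫴ mk (flip q) :) f := by
  have h1 : (mk (flip q) ⫴ one v) ⟫ (mk (flip p) ⫴ one ([B] ++ v)) =
      mk (flip p) ⫴ (mk (flip q) ⫴ one v) := by
    have h := par_seq_par (one []) (mk (flip p)) (mk (flip q) ⫴ one v) (one ([B] ++ v))
    rw [one_seq, seq_one, nil_par] at h
    exact h
  have h2 : ((mk (flip p) ⫴ mk (flip q)) ⫴ one v) = mk (flip p) ⫴ (mk (flip q) ⫴ one v) :=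
    (seq_one _).symm.trans ((par_assoc (mk (flip p)) (mk (flip q)) (one v)).trans (one_seq _))
  refine (seq_assoc _ _ _).symm.trans ?_
  exact congrArg (· ⟫ f) (h1.trans h2.symm)

theorem inst₂_par_seq (s : Mor [] ([B] ++ [B])) (t : Mor ([B] ++ [B]) ([B] ++ [B]))
    (f : Mor (([B] ++ [B]) ++ v) w) : inst₂ s ((t ⫴ one v) ⟫ f) = inst₂ (s ⟫ t) f := by
  rw [inst₂, inst₂, ← seq_assoc, par_seq_par, seq_one]

/-- The bias of the coin that always shows a given truth value. -/
def coin : Bool → unitInterval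
  | true => 1
  | false => 0

/-- A plain circuit for a constant truth value. -/
def lit : Bool → Circ [] [B]
  | true => flip 1
  | false => flip 1 ⨾ neg

theorem mk_lit (i : Bool) : mk (lit i) = mk (flip (coin i)) := by
  cases i
  · exact flip_zero.symm
  · rfl

theorem isPlain_lit (i : Bool) : IsPlain (lit i) := by
  cases i <;> simp [lit, IsPlain]

/-- The circuit `(b₁, b₂) ↦ (b₁ ∧ b₂, b₁)`. -/
def andFst : Circ [B, B] [B, B] :=
  (copy B ⊠ idn [B]) ⨾ (idn [B] ⊠ swap [B] [B]) ⨾ (conj ⊠ idn [B])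

/-- The circuit `(c₁, c₂) ↦ (c₁, c₁ ∨ c₂)`. -/
def fstOr : Circ [B, B] [B, B] :=
  (copy B ⊠ idn [B]) ⨾ (idn [B] ⊠ ((neg ⊠ neg) ⨾ conj ⨾ neg))

theorem isPlain_andFst : IsPlain andFst := by simp [andFst, IsPlain]

theorem isPlain_fstOr : IsPlain fstOr := by simp [fstOr, IsPlain]

theorem lit_andFst (i j : Bool) : mk ((lit i ⊠ lit j) ⨾ andFst) = mk (lit (i && j) ⊠ lit i) := by
  refine mk_eq_of_ev ⟨⟨isPlain_lit _, isPlain_lit _⟩, isPlain_andFst⟩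
    ⟨isPlain_lit _, isPlain_lit _⟩ fun x => ?_
  cases i <;> cases j <;> rfl

theorem lit_fstOr (i j : Bool) : mk ((lit i ⊠ lit j) ⨾ fstOr) = mk (lit i ⊠ lit (i || j)) := by
  refine mk_eq_of_ev ⟨⟨isPlain_lit _, isPlain_lit _⟩, isPlain_fstOr⟩
    ⟨isPlain_lit _, isPlain_lit _⟩ fun x => ?_
  cases i <;> cases j <;> rfl

theorem inst_lit (i j : Bool) (f : Mor ([B] ++ ([B] ++ v)) w) :
    inst (coin j) (inst (coin i) f) = inst₂ (mk (lit i ⊠ lit j)) f := by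
  rw [inst_inst, mk_par, mk_lit, mk_lit]

theorem ext_inst_inst {f g : Mor ([B] ++ ([B] ++ v)) w}
    (h : ∀ i j : Bool, inst (coin j) (inst (coin i) f) = inst (coin j) (inst (coin i) g)) :
    f = g :=
  ext_inst (ext_inst (h true true) (h true false)) (ext_inst (h false true) (h false false))

/-- The tosses `b₁, b₂` of coins with biases `p, q`, turned into `(b₁ ∧ b₂, b₁)`, have the same
joint distribution as the tosses `c₁, c₂` of coins with biases `p', q'`, turned into
`(c₁, c₁ ∨ c₂)`. -/
theorem mk_skew (p q p' q' : unitInterval) (hp' : (p' : ℝ) = p * q)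
    (hq' : (1 - p' : ℝ) * q' = p * (1 - q)) :
    mk ((idn [] ⊠ flip p ⊠ flip q) ⨾ andFst) = mk ((idn [] ⊠ flip p' ⊠ flip q') ⨾ fstOr) := by
  refine mk_eq.2 (.bool (by simp [IsBool, isPlain_andFst.isBool])
    (by simp [IsBool, isPlain_fstOr.isBool]) ?_)
  ext x : 1
  have h1 := sem_flip_flip (v := []) p q (c := andFst) isPlain_andFst x
  have h2 := sem_flip_flip (v := []) p' q' (c := fstOr) isPlain_fstOr x
  refine h1.trans (Eq.trans ?_ h2.symm)
  let t (i j : Bool) : Measure (Env [B, B]) := Measure.dirac (i, j, ())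
  have hp := p.2; have hq := q.2; have hpp := p'.2; have hqq := q'.2
  simp only [Set.mem_Icc] at hp hq hpp hqq
  have e1 : ENNReal.ofReal p * ENNReal.ofReal q =
      ENNReal.ofReal p' * ENNReal.ofReal q' + ENNReal.ofReal p' * ENNReal.ofReal (1 - q') := by
    rw [← mul_add, ofReal_add_one_sub, mul_one, ← ENNReal.ofReal_mul hp.1, hp']
  have e2 : ENNReal.ofReal p * ENNReal.ofReal (1 - q) =
      ENNReal.ofReal (1 - p') * ENNReal.ofReal q' := by
    rw [← ENNReal.ofReal_mul hp.1, ← ENNReal.ofReal_mul (by linarith), hq']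
  have e3 : ENNReal.ofReal (1 - p) * ENNReal.ofReal q +
      ENNReal.ofReal (1 - p) * ENNReal.ofReal (1 - q) =
        ENNReal.ofReal (1 - p') * ENNReal.ofReal (1 - q') := by
    rw [← mul_add, ofReal_add_one_sub, mul_one, ← ENNReal.ofReal_mul (by linarith)]
    congr 1
    linarith
  calc (ENNReal.ofReal p * ENNReal.ofReal q) • t true true
        + (ENNReal.ofReal p * ENNReal.ofReal (1 - q)) • t false true
        + (ENNReal.ofReal (1 - p) * ENNReal.ofReal q) • t false false
        + (ENNReal.ofReal (1 - p) * ENNReal.ofReal (1 - q)) • t false false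
    _ = (ENNReal.ofReal p' * ENNReal.ofReal q') • t true true
        + (ENNReal.ofReal p' * ENNReal.ofReal (1 - q')) • t true true
        + (ENNReal.ofReal (1 - p') * ENNReal.ofReal q') • t false true
        + (ENNReal.ofReal (1 - p') * ENNReal.ofReal (1 - q')) • t false false := by
      rw [e1, e2, ← e3, add_smul, add_smul, ← add_assoc]

/-- Skew associativity of convex combinations: both sides feed two coins to `G`, the case
distinction that yields `f` if its first input is true, and otherwise `g` or `h` by its
second input. -/
theorem mixM_mixM (p q p' q' : unitInterval) (hp' : (p' : ℝ) = p * q)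
    (hq' : (1 - p' : ℝ) * q' = p * (1 - q)) (f g h : Mor v w) :
    mixM p (mixM q f g) h = mixM p' f (mixM q' g h) := by
  let F : Mor ([B] ++ ([B] ++ v)) w := condM (condM f g) (snd [B] v ⟫ h)
  let G : Mor ([B] ++ ([B] ++ v)) w := condM (snd [B] v ⟫ f) (condM g h)
  have vF (i j : Bool) : inst (coin j) (inst (coin i) F) = if i then if j then f else g else h := by
    cases i <;> cases j <;>
      simp [F, coin, inst_one_condM, inst_zero_condM, inst_snd]
  have vG (i j : Bool) : inst (coin j) (inst (coin i) G) = if i then f else if j then g else h := by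
    cases i <;> cases j <;>
      simp [G, coin, inst_one_condM, inst_zero_condM, inst_snd]
  have hF : F = (mk andFst ⫴ one v) ⟫ G := by
    refine ext_inst_inst fun i j => ?_
    rw [inst_lit i j (_ ⟫ _)]
    refine Eq.trans ?_ (inst₂_par_seq _ _ _).symm
    refine Eq.trans ?_ (congrArg (inst₂ · G) (lit_andFst i j)).symm
    rw [← inst_lit, vF, vG]
    cases i <;> cases j <;> rfl
  -- `G` ignores its second input if the first one is true
  have hG : G = (mk fstOr ⫴ one v) ⟫ G := by
    refine ext_inst_inst fun i j => ?_
    rw [inst_lit i j (_ ⟫ _)]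
    refine Eq.trans ?_ (inst₂_par_seq _ _ _).symm
    refine Eq.trans ?_ (congrArg (inst₂ · G) (lit_fstOr i j)).symm
    rw [← inst_lit, vG, vG]
    cases i <;> cases j <;> rfl
  have hs := mk_skew p q p' q' hp' hq'
  have hs' : (mk (flip p) ⫴ mk (flip q)) ⟫ mk andFst =
      (mk (flip p') ⫴ mk (flip q')) ⟫ mk fstOr := by
    rw [← nil_par (mk (flip p) ⫴ mk (flip q)), ← nil_par (mk (flip p') ⫴ mk (flip q'))]
    exact hs
  calc mixM p (mixM q f g) h
    _ = inst q (inst p F) := by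
        change _ = inst q (mixM p _ _)
        rw [inst_mixM, inst_snd]; rfl
    _ = inst₂ (mk (flip p') ⫴ mk (flip q') :) G := by
        rw [inst_inst, hF]
        refine (inst₂_par_seq _ _ _).trans ?_
        refine (congrArg (inst₂ · G) hs').trans ?_
        refine (inst₂_par_seq _ _ _).symm.trans ?_
        exact congrArg (inst₂ _) hG.symm
    _ = inst q' (inst p' G) := (inst_inst _ _ _).symm
    _ = mixM p' f (mixM q' g h) := by
        change inst q' (mixM p' _ _) = _
        rw [inst_mixM, inst_snd]; rfl

theorem mixM_one (f g : Mor v w) : mixM 1 f g = f := inst_one_condM f g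

theorem mixM_zero (f g : Mor v w) : mixM 0 f g = g := inst_zero_condM f g

/-! ### Convex normal forms -/

/-- Having a convex normal form. -/
def HasCNF {m n : ℕ} (f : Mor (Rw m) (Rw n)) : Prop := ∃ c, IsCNF c ∧ mk c = f

/-- Convex combinations of convex normal forms have a convex normal form: skew associativity moves
the nesting to the right, and the weights `0` and `1` select one side. -/
theorem HasCNF.mixM {m n : ℕ} {f g : Mor (Rw m) (Rw n)} (hf : HasCNF f) (hg : HasCNF g)
    (p : unitInterval) : HasCNF (MixCirc.mixM p f g) := by
  obtain ⟨c, hc, rfl⟩ := hf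
  induction hc generalizing g p with
  | @gauss c hc =>
    obtain ⟨d, hd, rfl⟩ := hg
    rcases eq_or_ne p 0 with rfl | h0
    · rw [mixM_zero]; exact ⟨d, hd, rfl⟩
    rcases eq_or_ne p 1 with rfl | h1
    · rw [mixM_one]; exact ⟨c, .gauss hc, rfl⟩
    exact ⟨MixCirc.mix p c d, .mix ⟨bot_lt_iff_ne_bot.2 h0, lt_top_iff_ne_top.2 h1⟩ hc hd,
      mk_mix p c d⟩
  | @mix q hq c d hc hd ih =>
    rcases eq_or_ne p 0 with rfl | h0
    · rw [mixM_zero]; exact hg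
    rcases eq_or_ne p 1 with rfl | h1
    · rw [mixM_one]; exact ⟨_, .mix hq hc hd, rfl⟩
    have hp : (0 : ℝ) < p ∧ (p : ℝ) < 1 := ⟨unitInterval.pos_iff_ne_zero.2 h0,
      unitInterval.lt_one_iff_ne_one.2 h1⟩
    have hq0 : (0 : ℝ) < q ∧ (q : ℝ) < 1 := hq
    have hpq : (0 : ℝ) < p * q ∧ (p * q : ℝ) < p :=
      ⟨mul_pos hp.1 hq0.1, by nlinarith⟩
    have hd0 : (0 : ℝ) < 1 - p * q := by linarith
    -- the weight of the remaining part of the first normal form, given that `c` is not chosen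
    let q' : unitInterval := ⟨p * (1 - q) / (1 - p * q),
      div_nonneg (mul_nonneg hp.1.le (by linarith)) hd0.le, (div_le_one hd0).2 (by linarith)⟩
    have h := ih hg q'
    obtain ⟨d', hd', e⟩ := h
    refine ⟨MixCirc.mix (p * q) c d', .mix ⟨hpq.1, hpq.2.trans hp.2⟩ hc hd', ?_⟩
    rw [mk_mix, mk_mix, mixM_mixM p q (p * q) q' rfl, e]
    change (1 - (p * q : ℝ)) * (p * (1 - q) / (1 - p * q)) = _
    field_simp

/-! ### Boolean constants among real wires -/

/-- Bundles of real wires and constant truth values: `IsConst κ` says that `κ` is a parallel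
composition of real identity wires and of constants on Boolean wires. -/
inductive IsConst : {w' w : List Col} → Mor w' w → Prop
  | nil : IsConst (one [])
  | real {w' w : List Col} {κ : Mor w' w} (hκ : IsConst κ) :
      IsConst (w' := R :: w') (w := R :: w) (one [R] ⫴ κ)
  | bool {w' w : List Col} (i : Bool) {κ : Mor w' w} (hκ : IsConst κ) :
      IsConst (w' := w') (w := B :: w) (mk (lit i) ⫴ κ)

theorem IsConst.dom {κ : Mor w' w} (hκ : IsConst κ) : ∀ a ∈ w', a = R := by
  induction hκ with
  | nil => simp
  | real _ ih => simpa using ih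
  | bool _ _ ih => exact ih

theorem isConst_one (hw : ∀ a ∈ w, a = R) : IsConst (one w) := by
  induction w with
  | nil => exact .nil
  | cons a w ih =>
    obtain rfl : a = R := hw a (by simp)
    have h := IsConst.real (ih fun a ha => hw a (by simp [ha]))
    rw [one_par_one] at h
    exact h

theorem IsConst.eq_cast {κ : Mor w' w} (hκ : IsConst κ) (hw : ∀ a ∈ w, a = R) :
    ∃ h : w' = w, κ = cast h := by
  induction hκ with
  | nil => exact ⟨rfl, rfl⟩
  | real _ ih =>
    obtain ⟨rfl, rfl⟩ := ih fun a ha => hw a (by simp [ha])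
    exact ⟨rfl, one_par_one [R] _⟩
  | bool _ _ => exact nomatch hw B (by simp)

theorem IsConst.par {κ : Mor v' v} {μ : Mor w' w} (hκ : IsConst κ) (hμ : IsConst μ) :
    IsConst (κ ⫴ μ) := by
  induction hκ with
  | nil => rw [nil_par]; exact hμ
  | @real v' v κ _ ih =>
    have h : (one [R] ⫴ κ) ⫴ μ = one [R] ⫴ (κ ⫴ μ) :=
      (seq_one _).symm.trans ((par_assoc (one [R]) κ μ).trans (one_seq _))
    exact (congrArg IsConst h).mpr (.real ih)
  | @bool v' v i κ _ ih =>
    have h : (mk (lit i) ⫴ κ) ⫴ μ = mk (lit i) ⫴ (κ ⫴ μ) :=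
      (seq_one _).symm.trans ((par_assoc (mk (lit i)) κ μ).trans (one_seq _))
    exact (congrArg IsConst h).mpr (.bool i ih)

/-- A constant bundle splits along any partition of its output wires. -/
theorem IsConst.exists_par {κ : Mor u (v ++ w)} (hκ : IsConst κ) :
    ∃ (v' w' : List Col) (h : u = v' ++ w') (κ₁ : Mor v' v) (κ₂ : Mor w' w),
      IsConst κ₁ ∧ IsConst κ₂ ∧ κ = cast h ⟫ (κ₁ ⫴ κ₂) := by
  induction v generalizing u with
  | nil => exact ⟨[], u, rfl, one [], κ, .nil, hκ, by rw [nil_par]; exact (one_seq κ).symm⟩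
  | cons a v ih =>
    cases hκ with
    | @real u _ κ hκ =>
      obtain ⟨v', w', rfl, κ₁, κ₂, h₁, h₂, rfl⟩ := ih hκ
      refine ⟨R :: v', w', rfl, one [R] ⫴ κ₁, κ₂, .real h₁, h₂, ?_⟩
      have h : (one [R] ⫴ κ₁) ⫴ κ₂ = one [R] ⫴ (κ₁ ⫴ κ₂) :=
        (seq_one _).symm.trans ((par_assoc (one [R]) κ₁ κ₂).trans (one_seq _))
      rw [cast_rfl, one_seq]
      exact h.symm.trans (one_seq _).symm
    | @bool _ _ i κ hκ =>
      obtain ⟨v', w', rfl, κ₁, κ₂, h₁, h₂, rfl⟩ := ih hκ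
      refine ⟨v', w', rfl, mk (lit i) ⫴ κ₁, κ₂, .bool i h₁, h₂, ?_⟩
      have h : (mk (lit i) ⫴ κ₁) ⫴ κ₂ = mk (lit i) ⫴ (κ₁ ⫴ κ₂) :=
        (seq_one _).symm.trans ((par_assoc (mk (lit i)) κ₁ κ₂).trans (one_seq _))
      rw [cast_rfl, one_seq]
      exact h.symm.trans (one_seq _).symm

/-! ### Finite mixtures of Gaussian circuits -/

/-- Convex combinations of Gaussian circuits followed by constant truth values. -/
inductive MixG {u w : List Col} : Mor u w → Prop
  | base {w' : List Col} (g : Circ u w') (hg : IsGauss g) {κ : Mor w' w} (hκ : IsConst κ) :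
      MixG (mk g ⟫ κ)
  | mix (p : unitInterval) {f f' : Mor u w} (hf : MixG f) (hf' : MixG f') : MixG (mixM p f f')

theorem MixG.of_isConst {κ : Mor u w} (hκ : IsConst κ) : MixG κ := by
  have h := MixG.base (idn u) hκ.dom hκ
  rwa [mk_idn, one_seq] at h

theorem MixG.of_isGauss {g : Circ u w} (hg : IsGauss g) (hw : ∀ a ∈ w, a = R) : MixG (mk g) := by
  have h := MixG.base g hg (isConst_one hw)
  rwa [seq_one] at h

theorem MixG.comp_gauss {g : Circ u v} (hg : IsGauss g) {f : Mor v w} (hf : MixG f) :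
    MixG (mk g ⟫ f) := by
  induction hf with
  | base g' hg' hκ =>
    rw [← seq_assoc]
    exact .base (g ⨾ g') ⟨hg, hg'⟩ hκ
  | mix p _ _ ih ih' => rw [seq_mixM]; exact .mix p ih ih'

theorem MixG.par {f : Mor v w} {g : Mor v' w'} (hf : MixG f) (hg : MixG g) : MixG (f ⫴ g) := by
  induction hf with
  | base c hc hκ =>
    induction hg with
    | base d hd hμ =>
      rw [← par_seq_par]
      exact .base (c ⊠ d) ⟨hc, hd⟩ (hκ.par hμ)
    | mix p _ _ ih ih' => rw [par_mixM]; exact .mix p ih ih'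
  | mix p _ _ ih ih' => rw [mixM_par]; exact .mix p ih ih'

/-- Mixtures are preserved by any circuit that turns constants into mixtures. -/
theorem MixG.seq {f : Mor u v} (hf : MixG f) {g : Mor v w}
    (hg : ∀ {v' : List Col} {κ : Mor v' v}, IsConst κ → MixG (κ ⟫ g)) : MixG (f ⟫ g) := by
  induction hf with
  | base c hc hκ => rw [seq_assoc]; exact (hg hκ).comp_gauss hc
  | mix p _ _ ih ih' => rw [mixM_seq]; exact .mix p ih ih'

theorem par_one_nil (f : Mor [] [B]) : (f ⫴ one [] : Mor [] [B]) = f :=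
  (seq_one _).symm.trans ((par_nil f).trans (one_seq f))

theorem mixG_lit (i : Bool) : MixG (mk (lit i)) := by
  have h := MixG.of_isConst (IsConst.bool i .nil)
  exact (congrArg MixG (par_one_nil (mk (lit i)))).mp h

/-- A coin is the mixture of its two outcomes. -/
theorem mixG_flip (p : unitInterval) : MixG (mk (flip p)) := by
  have h (q : unitInterval) : inst (v := []) q (one [B]) = mk (flip q) :=
    (seq_one _).trans (par_one_nil (mk (flip q)))
  have e := mixM_inst (v := []) p (one [B])
  rw [h, h, h] at e
  rw [← e]
  exact .mix p (mixG_lit true) (flip_zero ▸ mixG_lit false)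

theorem mixG_sel (i : Bool) :
    MixG ((mk (lit i) ⫴ one [R, R]) ⟫ selC : Mor [R, R] [R]) := by
  rw [mk_lit]
  cases i
  · have h : (mk (flip 0) ⫴ one [R, R]) ⟫ selC = mk (del R ⊠ idn [R] :) :=
      mk_eq.2 (.axm .ite_false)
    exact h ▸ .of_isGauss (by simp [IsGauss]) (by simp)
  · have h : (mk (flip 1) ⫴ one [R, R]) ⟫ selC = mk (idn [R] ⊠ del R :) :=
      mk_eq.2 (.axm .ite_true)
    exact h ▸ .of_isGauss (by simp [IsGauss]) (by simp)

/-- Real generators, and more generally Gaussian circuits, turn constants into mixtures. -/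
theorem IsConst.mixG_seq_gauss {κ : Mor u v} (hκ : IsConst κ) {g : Circ v w} (hg : IsGauss g)
    (hv : ∀ a ∈ v, a = R) (hw : ∀ a ∈ w, a = R) : MixG (κ ⟫ mk g) := by
  obtain ⟨rfl, rfl⟩ := hκ.eq_cast hv
  rw [cast_rfl, one_seq]
  exact .of_isGauss hg hw

theorem IsConst.eq_lit {κ : Mor u [B]} (hκ : IsConst κ) :
    ∃ (h : u = []) (i : Bool), κ = cast h ⟫ mk (lit i) := by
  cases hκ with
  | bool i h =>
    cases h
    exact ⟨rfl, i, (par_one_nil _).trans (one_seq _).symm⟩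

/-- Every circuit turns constants into mixtures: with the outcomes of the coins fixed, all guards of
if-then-else gates are constants, and the mixture is taken over these outcomes. -/
theorem IsConst.mixG_seq (c : Circ v w) {κ : Mor u v} (hκ : IsConst κ) : MixG (κ ⟫ mk c) := by
  induction c generalizing u with
  | idn v => rw [mk_idn, seq_one]; exact .of_isConst hκ
  | swap v w =>
    obtain ⟨v', w', rfl, κ₁, κ₂, h₁, h₂, rfl⟩ := hκ.exists_par
    rw [cast_rfl, one_seq, mk_swap, par_sw]
    refine .base (Circ.swap v' w') (fun a ha => ?_) (h₂.par h₁)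
    exact (List.mem_append.1 ha).elim (h₁.dom a) (h₂.dom a)
  | seq c d ihc ihd =>
    rw [mk_seq, ← seq_assoc]
    exact (ihc hκ).seq ihd
  | par c d ihc ihd =>
    obtain ⟨v', w', rfl, κ₁, κ₂, h₁, h₂, rfl⟩ := hκ.exists_par
    rw [cast_rfl, one_seq, mk_par, par_seq_par]
    exact (ihc h₁).par (ihd h₂)
  | del a =>
    cases a with
    | R => exact hκ.mixG_seq_gauss rfl (by simp) (by simp)
    | B =>
      obtain ⟨rfl, i, rfl⟩ := hκ.eq_lit
      rw [eq_dl (_ ⟫ _)]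
      exact .of_isConst .nil
  | copy a =>
    cases a with
    | R => exact hκ.mixG_seq_gauss rfl (by simp) (by simp)
    | B =>
      obtain ⟨rfl, i, rfl⟩ := hκ.eq_lit
      have h : mk (lit i ⨾ Circ.copy B) = mk (lit i ⊠ lit i) := by
        refine mk_eq_of_ev ⟨isPlain_lit i, by simp [IsPlain]⟩ ⟨isPlain_lit i, isPlain_lit i⟩
          fun x => ?_
        cases i <;> rfl
      rw [cast_rfl, one_seq]
      exact (congrArg MixG h).mpr ((mixG_lit i).par (mixG_lit i))
  | conj =>
    obtain ⟨v', w', rfl, κ₁, κ₂, h₁, h₂, rfl⟩ := hκ.exists_par (v := [B]) (w := [B])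
    obtain ⟨rfl, i, rfl⟩ := h₁.eq_lit
    obtain ⟨rfl, j, rfl⟩ := h₂.eq_lit
    have h : mk ((lit i ⊠ lit j) ⨾ conj) = mk (lit (i && j)) := by
      refine mk_eq_of_ev ⟨⟨isPlain_lit i, isPlain_lit j⟩, by simp [IsPlain]⟩ (isPlain_lit _)
        fun x => ?_
      cases i <;> cases j <;> rfl
    have e := (one_seq _).trans (congrArg₂ Mor.par (one_seq (mk (lit i))) (one_seq (mk (lit j))))
    exact (congrArg MixG ((congrArg (· ⟫ mk conj) e).trans h)).mpr (mixG_lit _)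
  | neg =>
    obtain ⟨rfl, i, rfl⟩ := hκ.eq_lit
    have h : mk (lit i ⨾ neg) = mk (lit (!i)) := by
      refine mk_eq_of_ev ⟨isPlain_lit i, by simp [IsPlain]⟩ (isPlain_lit _) fun x => ?_
      cases i <;> rfl
    rw [cast_rfl, one_seq]
    exact (congrArg MixG h).mpr (mixG_lit _)
  | flip p =>
    obtain ⟨rfl, rfl⟩ := hκ.eq_cast (by simp)
    rw [cast_rfl, one_seq]
    exact mixG_flip p
  | zero => exact hκ.mixG_seq_gauss trivial (by simp) (by simp)
  | add => exact hκ.mixG_seq_gauss trivial (by simp) (by simp)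
  | scal k => exact hκ.mixG_seq_gauss trivial (by simp) (by simp)
  | one => exact hκ.mixG_seq_gauss trivial (by simp) (by simp)
  | normal => exact hκ.mixG_seq_gauss trivial (by simp) (by simp)
  | sel =>
    cases hκ with
    | bool i h =>
      obtain ⟨rfl, rfl⟩ := h.eq_cast (by simp)
      exact mixG_sel i

theorem MixG.hasCNF {m n : ℕ} {f : Mor (Rw m) (Rw n)} (hf : MixG f) : HasCNF f := by
  induction hf with
  | base g hg hκ =>
    obtain ⟨rfl, rfl⟩ := hκ.eq_cast fun a ha => List.eq_of_mem_replicate ha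
    exact ⟨g, .gauss hg, by rw [cast_rfl, seq_one]⟩
  | mix p _ _ ih ih' => exact ih.mixM ih' p

/-- Every circuit on real wires has a convex normal form. -/
theorem hasCNF {m n : ℕ} (f : Mor (Rw m) (Rw n)) : HasCNF f := by
  obtain ⟨c, rfl⟩ := mk_surjective f
  have h := (isConst_one fun a ha => List.eq_of_mem_replicate (a := R) (n := m) ha).mixG_seq c
  rw [one_seq] at h
  exact h.hasCNF

/-- The Boolean inputs are removed one at a time by case distinction. -/
theorem exists_isNF (p : ℕ) {m n : ℕ} (f : Mor (Bw p ++ Rw m) (Rw n)) :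
    ∃ d : Circ (Bw p ++ Rw m) (Rw n), IsNF d ∧ mk d = f := by
  induction p with
  | zero =>
    obtain ⟨d, hd, e⟩ := hasCNF (m := m) f
    exact ⟨d, .leaf hd, e⟩
  | succ p ih =>
    obtain ⟨c, hc, ec⟩ := ih (inst 1 f)
    obtain ⟨d, hd, ed⟩ := ih (inst 0 f)
    refine ⟨cond c d, .node hc hd, ?_⟩
    rw [mk_cond, ec, ed]
    exact condM_inst f

end MixCirc

theorem mainTheorem3 (p m n : ℕ)
    (c : MixCirc.Circ (MixCirc.Bw p ++ MixCirc.Rw m) (MixCirc.Rw n)) :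
    ∃ d : MixCirc.Circ (MixCirc.Bw p ++ MixCirc.Rw m) (MixCirc.Rw n),
      MixCirc.IsNF d ∧ MixCirc.CGM c d := by
  obtain ⟨d, hd, e⟩ := MixCirc.exists_isNF p (MixCirc.mk c)
  exact ⟨d, hd, MixCirc.mk_eq.1 e.symm⟩
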